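/- **Setting.** For $\tau\in\mathbb C$ with $\operatorname{Im}\tau>0$ and $q=e^{2\pi i\tau}$ put $\Theta[c_1,c_2](u,\tau)=\sum_{m\in\mathbb Z}q^{(m+c_1)^2/2}e^{2\pi i(u+c_2)(m+c_1)}$ and $\Theta_1=\Theta[\frac12,\frac12]$, $\Theta_2=\Theta[\frac12,0]$, $\Theta_3=\Theta[0,0]$, $\Theta_4=\Theta[0,\frac12]$, $\Theta_i(\tau)=\Theta_i(0,\tau)$. Let $$\alpha_1(u)=\Theta_1(2u,2\tau),\quad \alpha_2(u)=\Theta_4(2u,2\tau),\quad \alpha_3(u)=\frac{\Theta_4(2\tau)^2}{\Theta_2(2\tau)\Theta_3(2\tau)}\Theta_2(2u,2\tau)\Theta_3(2u,2\tau),\quad a=\frac{\Theta_2(2\tau)^4+\Theta_3(2\tau)^4}{\Theta_2(2\tau)^2\Theta_3(2\tau)^2}$$ and $W=x_1^4+x_2^4-x_3^2-a\,x_1^2x_2^2$. Call $u\in\mathbb C$ generic if $\alpha_1(u)\alpha_2(u)\alpha_3(u)\neq0$. For $p=(p_1,p_2,p_3)=(\alpha_1(u),\alpha_2(u),\alpha_3(u))$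 with $u$ generic let $Q^{\mathcal L}(u)=\begin{pmatrix}0&E^{\mathcal L}\\J^{\mathcal L}&0\end{pmatrix}$ ("long") and $Q^{\mathcal S}(u)=\begin{pmatrix}0&E^{\mathcal S}\\J^{\mathcal S}&0\end{pmatrix}$ ("short"), where $$E^{\mathcal L}=\begin{pmatrix}\frac{p_1}{p_2}x_1^2-\frac{p_2}{p_1}x_2^2&\frac{x_3}{p_3}-\frac{x_1x_2}{p_1p_2}\\ p_3x_3+\frac{p_3^2}{p_1p_2}x_1x_2&\frac{p_2}{p_1}x_1^2-\frac{p_1}{p_2}x_2^2\end{pmatrix},\quad J^{\mathcal L}=\begin{pmatrix}\frac{p_2}{p_1}x_1^2-\frac{p_1}{p_2}x_2^2&-\frac{x_3}{p_3}+\frac{x_1x_2}{p_1p_2}\\ -p_3x_3-\frac{p_3^2}{p_1p_2}x_1x_2&\frac{p_1}{p_2}x_1^2-\frac{p_2}{p_1}x_2^2\end{pmatrix},$$ $$E^{\mathcal S}=\begin{pmatrix}p_1x_1+p_2x_2&p_3x_3+\frac{p_3^2}{p_1p_2}x_1x_2\\ \frac{x_1x_2}{p_1p_2}-\frac{x_3}{p_3}&-g\end{pmatrix},\quad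 J^{\mathcal S}=\begin{pmatrix}g&p_3x_3+\frac{p_3^2}{p_1p_2}x_1x_2\\ \frac{x_1x_2}{p_1p_2}-\frac{x_3}{p_3}&-p_1x_1-p_2x_2\end{pmatrix},$$ $g=\frac{x_1^3}{p_1}-\frac{p_1}{p_2^2}x_1x_2^2+\frac{x_2^3}{p_2}-\frac{p_2}{p_1^2}x_1^2x_2$. **Open string states.** Between a brane with parameters $p=\alpha(u)$ and one with parameters $r=\alpha(v)$ ($u,v$ generic) there are fermions $\psi=\begin{pmatrix}0&\psi^{(0)}\\\psi^{(1)}&0\end{pmatrix}$ and bosons $\phi=\begin{pmatrix}\phi^{(0)}&0\\0&\phi^{(1)}\end{pmatrix}$. In each case write the upper block as $M=M(p,r)=\begin{pmatrix}A&B\\C&D\end{pmatrix}$. For the long-long states: - $\psi_{\mathcal{LL}}$: $A=\big(\frac1{p_1p_2}+\frac{r_3}{r_1r_2p_3}\big)x_1$, $B=\big(-\frac{r_1}{r_2p_3r_3}+\frac{p_2^2r_2}{p_1^2r_1p_3r_3}\big)x_2$, $C=\big(\frac{p_1}{p_2}-\frac{p_2r_2^2}{p_1r_1^2}\big)x_2$,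 $D=\big(-\frac{p_2}{p_1r_1^2}-\frac{r_2p_3}{p_1^2r_1r_3}\big)x_1$; - $\bar\psi_{\mathcal{LL}}$: $A=\big(\frac{r_2}{p_1}+\frac{p_2r_3}{r_1p_3}\big)x_2$, $B=\big(-\frac{p_1^2r_1}{p_2p_3r_3}+\frac{p_2r_2^2}{r_1p_3r_3}\big)x_1$, $C=\big(\frac{p_1r_1^2}{r_2}-\frac{p_2^2r_2}{p_1}\big)x_1$, $D=\big(-\frac{p_1}{r_2}-\frac{r_1p_3}{p_2r_3}\big)x_2$; - $\phi_{\mathcal{LL}}$: $A=\big(p_1+\frac{p_1^2p_2r_3}{r_1r_2p_3}\big)x_2$, $B=\big(-\frac{p_1^2r_1p_2}{r_2p_3r_3}+\frac{p_1^4r_2}{r_1p_2p_3r_3}\big)x_1$, $C=\big(-p_1p_2^2+\frac{p_1^3r_2^2}{r_1^2}\big)x_1$, $D=\big(\frac{p_1^3}{r_1^2}+\frac{p_1^2r_2p_3}{r_1p_2r_3}\big)x_2$; - $\bar\phi_{\mathcal{LL}}$: $A=\big(\frac{p_1}{r_1}+\frac{r_2p_3}{p_2r_3}\big)x_1$, $B=\big(-\frac{r_1p_2^2}{p_1r_3^2}+\frac{p_1r_2^2}{r_1r_3^2}\big)x_2$,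 $C=\big(-\frac{r_1^2p_2p_3}{r_2r_3}+\frac{p_1^2r_2p_3}{p_2r_3}\big)x_2$, $D=\big(\frac{r_1p_3^2}{p_1r_3^2}+\frac{p_2p_3}{r_2r_3}\big)x_1$. The lower block is $\begin{pmatrix}D'&-B'\\-C'&A'\end{pmatrix}$ for $\psi_{\mathcal{LL}},\bar\psi_{\mathcal{LL}}$, where the prime means that $p$ and $r$ are exchanged, and $\begin{pmatrix}\frac{r_3}{p_3}D&\frac1{p_3r_3}C\\p_3r_3B&\frac{p_3}{r_3}A\end{pmatrix}$ for $\phi_{\mathcal{LL}},\bar\phi_{\mathcal{LL}}$. For the states from a short to a long brane: - $\psi_{\mathcal{SL}}$: $A=\frac{p_1p_3}{p_2^2}-\frac{p_1^2r_3}{r_1p_2r_2}$, $B=-\frac{p_1^3r_1}{p_2^2r_2r_3}+\frac{p_1r_2}{r_1r_3}$, $C=\big(\frac1{p_3}-\frac{p_1^2r_1^2}{p_2^2r_2^2p_3}\big)x_1+\big(\frac{p_1^3}{p_2^3p_3}-\frac{p_1r_2^2}{r_1^2p_2p_3}\big)x_2$, $D=\big(\frac{p_1^2}{p_2^2r_2^2p_3}-\frac{p_1r_1}{p_2^3r_2r_3}\big)x_2+\big(-\frac{p_1}{r_1^2p_2p_3}+\frac{r_2}{r_1p_2^2r_3}\big)x_1$;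 - $\phi_{\mathcal{SL}}$: $A=\frac{p_2p_3}{p_1^2}-\frac{p_2^2r_3}{p_1r_1r_2}$, $B=-\frac{r_1p_2^3}{p_1^2r_2r_3}+\frac{p_2r_2}{r_1r_3}$, $C=\big(\frac1{p_3}-\frac{r_1^2p_2^2}{p_1^2r_2^2p_3}\big)x_2+\big(\frac{p_2^3}{p_1^3p_3}-\frac{p_2r_2^2}{p_1r_1^2p_3}\big)x_1$, $D=\big(\frac{p_2^2}{p_1^2r_2^2p_3}-\frac{r_1p_2}{p_1^3r_2r_3}\big)x_1+\big(-\frac{p_2}{p_1r_1^2p_3}+\frac{r_2}{p_1^2r_1r_3}\big)x_2$; both with lower block $\begin{pmatrix}-p_3r_3D&-\frac{p_3}{r_3}C\\\frac{r_3}{p_3}B&\frac1{p_3r_3}A\end{pmatrix}$. For the states from a long to a short brane: - $\psi_{\mathcal{LS}}$: $A=\frac1{p_3}-\frac{p_1p_2r_3}{r_1r_2p_3^2}$, $B=\big(\frac{p_2^3r_3}{p_1r_1p_3^2}-\frac{p_1r_1p_2r_3}{r_2^2p_3^2}\big)x_2+\big(\frac{p_1^3r_3}{p_2r_2p_3^2}-\frac{p_1p_2r_2r_3}{r_1^2p_3^2}\big)x_1$,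 $C=-\frac{p_1^2r_1}{r_2p_3}+\frac{p_2^2r_2}{r_1p_3}$, $D=\big(\frac{p_1r_3}{p_2r_2}-\frac{p_1^2r_3^2}{r_1r_2^2p_3}\big)x_2+\big(-\frac{p_2r_3}{p_1r_1}+\frac{p_2^2r_3^2}{r_1^2r_2p_3}\big)x_1$, lower block $\begin{pmatrix}\frac1{p_3r_3}D&-\frac{r_3}{p_3}C\\\frac{p_3}{r_3}B&-p_3r_3A\end{pmatrix}$; - $\phi_{\mathcal{LS}}$: $A=\big(\frac1{r_1^2r_2p_3}-\frac1{p_1r_1p_2r_3}\big)x_2+\big(-\frac{p_1^2}{r_1^3p_2^2p_3}+\frac{p_1r_2}{r_1^2p_2^3r_3}\big)x_1$, $B=-\frac1{p_3}+\frac{p_1^2r_2^2}{r_1^2p_2^2p_3}$, $C=\big(-\frac{p_1}{p_2r_2r_3}+\frac{p_1^3r_2}{r_1^2p_2^3r_3}\big)x_2+\big(\frac{p_2}{p_1r_1r_3}-\frac{p_1r_2^2}{r_1^3p_2r_3}\big)x_1$, $D=-\frac{r_2p_3}{r_1p_2^2}+\frac{p_1r_3}{r_1^2p_2}$, lower block $\begin{pmatrix}-\frac1{p_3r_3}D&\frac{r_3}{p_3}C\\-\frac{p_3}{r_3}B&p_3r_3A\end{pmatrix}$.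 **Correlators.** For states $\Psi_1,\Psi_2,\Psi_3$ from $Q_1(u_1)$ to $Q_2(u_2)$, from $Q_2(u_2)$ to $Q_3(u_3)$ and from $Q_3(u_3)$ to $Q_1(u_1)$ let $$\langle\Psi_1\Psi_2\Psi_3\rangle=\frac1{(2\pi i)^3}\oint\frac{\mathrm{STr}\big((\partial Q_1)^{\wedge3}\Psi_1\Psi_2\Psi_3\big)}{\partial_1W\,\partial_2W\,\partial_3W}\,d^3x,\qquad(\partial Q)^{\wedge3}=\frac1{3!}\sum_{\sigma\in S_3}\operatorname{sgn}(\sigma)\,\partial_{\sigma(1)}Q\,\partial_{\sigma(2)}Q\,\partial_{\sigma(3)}Q,$$ the Grothendieck residue at the origin. **A-model.** On the square torus $\mathbb R^2/\mathbb Z^2$ take $L_1:\ y=-x+\beta_1$, $L_2:\ y=x+\beta_2$, $S_1:\ x=\beta_3/2$ with winding vectors $(-1,1),(1,1),(0,-1)$, flat connections with holonomies $\alpha_1,\alpha_2,\alpha_3/2$ (all $\alpha_i,\beta_i$ real), and signs $o=(o_1,o_2,o_3)$, where $o_i=1$ for the brane and $o_i=-1$ for its antibrane. For $k\in\mathbb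 Z$ let $A_k$ be the area of the triangle in $\mathbb R^2$ enclosed by the lifts $y=-x+\beta_1$, $y=x+\beta_2+k$, $x=\beta_3/2$, and let $W_k$ be the sum over its sides, run through in the order $L_2,S_1,L_1$ of the closed boundary path, of $o_i$ times the holonomy times the signed length in units of the winding vector. Put $C=\sum_{k\text{ odd}}e^{2\pi i\tau A_k}e^{2\pi iW_k}$ and $\bar C=\sum_{k\text{ even}}e^{2\pi i\tau A_k}e^{2\pi iW_k}$. Let $\beta=-\beta_1+\beta_2+\beta_3$, $\alpha=o_1\alpha_1+o_2\alpha_2+o_3\alpha_3$, $2u=\beta\tau+\alpha$, and $$\Delta=\sum_{n\in\mathbb Z}q^{(n+\frac12)^2}e^{2\pi i(n+\frac12)2u},\qquad\bar\Delta=\sum_{n\in\mathbb Z}q^{n^2}e^{2\pi i\,2un}.$$ **Theorem.** There are functions $N_s(\tau;u,v)$, one for each of the eight states $s$, and signs that depend only on the correlator, neither on $\tau$ nor on the moduli, such that the following hold for all $\tau$ with $\operatorname{Im}\tau>0$. 1. For generic $u$: $\alpha_1(u)^4+\alpha_2(u)^4-\alpha_3(u)^2-a\,\alpha_1(u)^2\alpha_2(u)^2=0$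 and $Q^{\mathcal L}(u)^2=Q^{\mathcal S}(u)^2=W\cdot\mathbf 1$. For generic $u,v$ every state $\Psi$ above from $Q_A(u)$ to $Q_B(v)$ satisfies $Q_A\Psi-(-1)^{|\Psi|}\Psi Q_B=0$. The normalization factor $N_s(\tau;\cdot,\cdot)$ is holomorphic at all pairs of generic points, and there it vanishes exactly where the matrix of $s$ is zero. 2. For all generic $u_1,u_2,u_3$, up to the sign and the factor $N_{s_1}(\tau;u_1,u_2)N_{s_2}(\tau;u_2,u_3)N_{s_3}(\tau;u_3,u_1)$ of the three inserted states $s_1,s_2,s_3$ (with moduli $(u_1,u_2)$, $(u_2,u_3)$, $(u_3,u_1)$), $$\langle\psi_{\mathcal{LL}}\psi_{\mathcal{LS}}\psi_{\mathcal{SL}}\rangle=\Theta_1(2(u_1+u_2-u_3),2\tau),\quad\langle\bar\psi_{\mathcal{LL}}\psi_{\mathcal{LS}}\psi_{\mathcal{SL}}\rangle=\Theta_4(2(u_1+u_2-u_3),2\tau),$$ $$\langle\psi_{\mathcal{LL}}\phi_{\mathcal{LS}}\phi_{\mathcal{SL}}\rangle=\Theta_1(2(u_1+u_2+u_3),2\tau),\quad\langle\bar\psi_{\mathcal{LL}}\phi_{\mathcal{LS}}\phi_{\mathcal{SL}}\rangle=\Theta_4(2(u_1+u_2+u_3),2\tau),$$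 $$\langle\phi_{\mathcal{LL}}\psi_{\mathcal{LS}}\phi_{\mathcal{SL}}\rangle=\Theta_1(2(u_1-u_2+u_3),2\tau),\quad\langle\bar\phi_{\mathcal{LL}}\psi_{\mathcal{LS}}\phi_{\mathcal{SL}}\rangle=\Theta_4(2(u_1-u_2+u_3),2\tau),$$ $$\langle\phi_{\mathcal{LL}}\phi_{\mathcal{LS}}\psi_{\mathcal{SL}}\rangle=\Theta_1(2(u_1-u_2-u_3),2\tau),\quad\langle\bar\phi_{\mathcal{LL}}\phi_{\mathcal{LS}}\psi_{\mathcal{SL}}\rangle=\Theta_4(2(u_1-u_2-u_3),2\tau).$$ 3. For the configurations $o=(-1,1,1),\ (-1,1,-1),\ (-1,-1,1),\ (1,1,1)$ and all real $\alpha_i,\beta_i$ the sums converge, $C=e^{2\pi i\tau\beta^2/4}e^{2\pi i\beta\alpha/2}\Delta$, $\bar C=e^{2\pi i\tau\beta^2/4}e^{2\pi i\beta\alpha/2}\bar\Delta$, and $\Delta=\Theta_2(2u,2\tau)$, $\bar\Delta=\Theta_3(2u,2\tau)$. 4. $\Theta_2(z,\tau)=-\Theta_1(z+\frac12,\tau)$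 and $\Theta_3(z,\tau)=\Theta_4(z+\frac12,\tau)$ for all $z\in\mathbb C$. 5. Let $2u_1=\alpha_2+o_2\beta_2\tau+2\delta_1$, $2u_2=-\alpha_1+o_1\beta_1\tau+2\delta_2$, $2u_3=-\alpha_3-o_3\beta_3\tau+2\delta_3$ with shifts of the origin $\delta_i\in\mathbb C$ such that $2(o_2\delta_1-o_1\delta_2-o_3\delta_3)=\frac12$, and suppose that $u_1,u_2,u_3$ are generic. Then the four pairs of correlators in 2 at $(u_1,u_2,u_3)$ are equal, up to signs and the same normalization factors, to the pairs $\Delta,\bar\Delta$ of the four configurations in 3, in the order listed. -/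

import Mathlib

noncomputable section

namespace QuarticTorus

open MvPolynomial Matrix

/-! ### Theta functions -/

/-- The theta function with characteristics
`Θ[c₁,c₂](u,τ) = ∑_{m ∈ ℤ} q^((m+c₁)²/2) e^(2πi(u+c₂)(m+c₁))`, where `q = e^(2πiτ)`. -/
def thetaChar (c₁ c₂ : ℝ) (u τ : ℂ) : ℂ :=
  ∑' m : ℤ, Complex.exp (2 * Real.pi * Complex.I * τ * (((m : ℂ) + c₁) ^ 2 / 2)) *
    Complex.exp (2 * Real.pi * Complex.I * (u + c₂) * ((m : ℂ) + c₁))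

def Theta1 (u τ : ℂ) : ℂ := thetaChar (1 / 2) (1 / 2) u τ
def Theta2 (u τ : ℂ) : ℂ := thetaChar (1 / 2) 0 u τ
def Theta3 (u τ : ℂ) : ℂ := thetaChar 0 0 u τ
def Theta4 (u τ : ℂ) : ℂ := thetaChar 0 (1 / 2) u τ

/-- The uniformized brane parameters `(α₁, α₂, α₃)`, indexed by `0, 1, 2`. -/
def alpha (τ u : ℂ) : Fin 3 → ℂ :=
  ![Theta1 (2 * u) (2 * τ),
    Theta4 (2 * u) (2 * τ),
    Theta4 0 (2 * τ) ^ 2 / (Theta2 0 (2 * τ) * Theta3 0 (2 * τ)) *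
      (Theta2 (2 * u) (2 * τ) * Theta3 (2 * u) (2 * τ))]

/-- The bulk parameter `a(τ)` of the superpotential. -/
def bulkParam (τ : ℂ) : ℂ :=
  (Theta2 0 (2 * τ) ^ 4 + Theta3 0 (2 * τ) ^ 4) /
    (Theta2 0 (2 * τ) ^ 2 * Theta3 0 (2 * τ) ^ 2)

/-- The boundary modulus `u` is generic if no `αⱼ(u,τ)` vanishes. The matrix factorizations and
the open string states have the `αⱼ` in their denominators, so this is where they are defined. -/
def IsGeneric (τ u : ℂ) : Prop := ∀ j, alpha τ u j ≠ 0

/-! ### The superpotential and the matrix factorizations -/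

/-- Polynomials in `x₁, x₂, x₃`, which are `X 0, X 1, X 2`. -/
abbrev Poly : Type := MvPolynomial (Fin 3) ℂ

abbrev Block : Type := Matrix (Fin 2) (Fin 2) Poly

/-- `ℤ/2`-graded `4 × 4` matrices in block form. -/
abbrev SuperMatrix : Type := Matrix (Fin 2 ⊕ Fin 2) (Fin 2 ⊕ Fin 2) Poly

/-- `W = x₁⁴ + x₂⁴ - x₃² - a x₁² x₂²`. -/
def superpotential (a : ℂ) : Poly :=
  X 0 ^ 4 + X 1 ^ 4 - X 2 ^ 2 - C a * X 0 ^ 2 * X 1 ^ 2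

def oddMatrix (M₀ M₁ : Block) : SuperMatrix := fromBlocks 0 M₀ M₁ 0

def evenMatrix (M₀ M₁ : Block) : SuperMatrix := fromBlocks M₀ 0 0 M₁

/-- The block `E` of the short brane with parameters `p = (α₁, α₂, α₃)`. -/
def shortE (p : Fin 3 → ℂ) : Block :=
  !![C (p 0) * X 0 + C (p 1) * X 1,
     C (p 2) * X 2 + C (p 2 ^ 2 / (p 0 * p 1)) * X 0 * X 1;
     C (1 / (p 0 * p 1)) * X 0 * X 1 - C (1 / p 2) * X 2,
     -C (1 / p 0) * X 0 ^ 3 + C (p 0 / p 1 ^ 2) * X 0 * X 1 ^ 2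
       - C (1 / p 1) * X 1 ^ 3 + C (p 1 / p 0 ^ 2) * X 0 ^ 2 * X 1]

/-- The block `J` of the short brane. -/
def shortJ (p : Fin 3 → ℂ) : Block :=
  !![C (1 / p 0) * X 0 ^ 3 - C (p 0 / p 1 ^ 2) * X 0 * X 1 ^ 2
       + C (1 / p 1) * X 1 ^ 3 - C (p 1 / p 0 ^ 2) * X 0 ^ 2 * X 1,
     C (p 2) * X 2 + C (p 2 ^ 2 / (p 0 * p 1)) * X 0 * X 1;
     C (1 / (p 0 * p 1)) * X 0 * X 1 - C (1 / p 2) * X 2,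
     -C (p 0) * X 0 - C (p 1) * X 1]

/-- The block `E` of the long brane. -/
def longE (p : Fin 3 → ℂ) : Block :=
  !![C (p 0 / p 1) * X 0 ^ 2 - C (p 1 / p 0) * X 1 ^ 2,
     C (1 / p 2) * X 2 - C (1 / (p 0 * p 1)) * X 0 * X 1;
     C (p 2) * X 2 + C (p 2 ^ 2 / (p 0 * p 1)) * X 0 * X 1,
     C (p 1 / p 0) * X 0 ^ 2 - C (p 0 / p 1) * X 1 ^ 2]

/-- The block `J` of the long brane. -/
def longJ (p : Fin 3 → ℂ) : Block :=
  !![C (p 1 / p 0) * X 0 ^ 2 - C (p 0 / p 1) * X 1 ^ 2,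
     -C (1 / p 2) * X 2 + C (1 / (p 0 * p 1)) * X 0 * X 1;
     -C (p 2) * X 2 - C (p 2 ^ 2 / (p 0 * p 1)) * X 0 * X 1,
     C (p 0 / p 1) * X 0 ^ 2 - C (p 1 / p 0) * X 1 ^ 2]

inductive Brane
  | long
  | short

/-- The matrix factorization `Q` with off-diagonal blocks `E` and `J`. -/
def Brane.Q : Brane → (Fin 3 → ℂ) → SuperMatrix
  | .long, p => oddMatrix (longE p) (longJ p)
  | .short, p => oddMatrix (shortE p) (shortJ p)

/-! ### The open string states

Fermions (odd) are called `psi`, bosons (even) `phi`. The states between two long branes have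
R-charge `1/2`, those between a long and a short brane have R-charge `1/4`. The parameters of the
first brane are `p`, those of the second brane are `q`. -/

def psiLL₀ (p q : Fin 3 → ℂ) : Block :=
  !![C (1 / (p 0 * p 1) + q 2 / (q 0 * q 1 * p 2)) * X 0,
     C (-q 0 / (q 1 * p 2 * q 2) + p 1 ^ 2 * q 1 / (p 0 ^ 2 * q 0 * p 2 * q 2)) * X 1;
     C (p 0 / p 1 - p 1 * q 1 ^ 2 / (p 0 * q 0 ^ 2)) * X 1,
     C (-p 1 / (p 0 * q 0 ^ 2) - q 1 * p 2 / (p 0 ^ 2 * q 0 * q 2)) * X 0]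

def psiBarLL₀ (p q : Fin 3 → ℂ) : Block :=
  !![C (q 1 / p 0 + p 1 * q 2 / (q 0 * p 2)) * X 1,
     C (-(p 0 ^ 2 * q 0) / (p 1 * p 2 * q 2) + p 1 * q 1 ^ 2 / (q 0 * p 2 * q 2)) * X 0;
     C (p 0 * q 0 ^ 2 / q 1 - p 1 ^ 2 * q 1 / p 0) * X 0,
     C (-p 0 / q 1 - q 0 * p 2 / (p 1 * q 2)) * X 1]

def phiLL₀ (p q : Fin 3 → ℂ) : Block :=
  !![C (p 0 + p 0 ^ 2 * p 1 * q 2 / (q 0 * q 1 * p 2)) * X 1,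
     C (-(p 0 ^ 2 * q 0 * p 1) / (q 1 * p 2 * q 2)
       + p 0 ^ 4 * q 1 / (q 0 * p 1 * p 2 * q 2)) * X 0;
     C (-(p 0 * p 1 ^ 2) + p 0 ^ 3 * q 1 ^ 2 / q 0 ^ 2) * X 0,
     C (p 0 ^ 3 / q 0 ^ 2 + p 0 ^ 2 * q 1 * p 2 / (q 0 * p 1 * q 2)) * X 1]

def phiBarLL₀ (p q : Fin 3 → ℂ) : Block :=
  !![C (p 0 / q 0 + q 1 * p 2 / (p 1 * q 2)) * X 0,
     C (-(q 0 * p 1 ^ 2) / (p 0 * q 2 ^ 2) + p 0 * q 1 ^ 2 / (q 0 * q 2 ^ 2)) * X 1;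
     C (-(q 0 ^ 2 * p 1 * p 2) / (q 1 * q 2) + p 0 ^ 2 * q 1 * p 2 / (p 1 * q 2)) * X 1,
     C (q 0 * p 2 ^ 2 / (p 0 * q 2 ^ 2) + p 1 * p 2 / (q 1 * q 2)) * X 0]

def psiSL₀ (p q : Fin 3 → ℂ) : Block :=
  !![C (p 0 * p 2 / p 1 ^ 2 - p 0 ^ 2 * q 2 / (q 0 * p 1 * q 1)),
     C (-(p 0 ^ 3 * q 0) / (p 1 ^ 2 * q 1 * q 2) + p 0 * q 1 / (q 0 * q 2));
     C (1 / p 2 - p 0 ^ 2 * q 0 ^ 2 / (p 1 ^ 2 * q 1 ^ 2 * p 2)) * X 0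
       + C (p 0 ^ 3 / (p 1 ^ 3 * p 2) - p 0 * q 1 ^ 2 / (q 0 ^ 2 * p 1 * p 2)) * X 1,
     C (p 0 ^ 2 / (p 1 ^ 2 * q 1 ^ 2 * p 2) - p 0 * q 0 / (p 1 ^ 3 * q 1 * q 2)) * X 1
       + C (-p 0 / (q 0 ^ 2 * p 1 * p 2) + q 1 / (q 0 * p 1 ^ 2 * q 2)) * X 0]

def phiSL₀ (p q : Fin 3 → ℂ) : Block :=
  !![C (p 1 * p 2 / p 0 ^ 2 - p 1 ^ 2 * q 2 / (p 0 * q 0 * q 1)),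
     C (-(q 0 * p 1 ^ 3) / (p 0 ^ 2 * q 1 * q 2) + p 1 * q 1 / (q 0 * q 2));
     C (1 / p 2 - q 0 ^ 2 * p 1 ^ 2 / (p 0 ^ 2 * q 1 ^ 2 * p 2)) * X 1
       + C (p 1 ^ 3 / (p 0 ^ 3 * p 2) - p 1 * q 1 ^ 2 / (p 0 * q 0 ^ 2 * p 2)) * X 0,
     C (p 1 ^ 2 / (p 0 ^ 2 * q 1 ^ 2 * p 2) - q 0 * p 1 / (p 0 ^ 3 * q 1 * q 2)) * X 0
       + C (-p 1 / (p 0 * q 0 ^ 2 * p 2) + q 1 / (p 0 ^ 2 * q 0 * q 2)) * X 1]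

def psiLS₀ (p q : Fin 3 → ℂ) : Block :=
  !![C (1 / p 2 - p 0 * p 1 * q 2 / (q 0 * q 1 * p 2 ^ 2)),
     C (p 1 ^ 3 * q 2 / (p 0 * q 0 * p 2 ^ 2)
         - p 0 * q 0 * p 1 * q 2 / (q 1 ^ 2 * p 2 ^ 2)) * X 1
       + C (p 0 ^ 3 * q 2 / (p 1 * q 1 * p 2 ^ 2)
         - p 0 * p 1 * q 1 * q 2 / (q 0 ^ 2 * p 2 ^ 2)) * X 0;
     C (-(p 0 ^ 2 * q 0) / (q 1 * p 2) + p 1 ^ 2 * q 1 / (q 0 * p 2)),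
     C (p 0 * q 2 / (p 1 * q 1) - p 0 ^ 2 * q 2 ^ 2 / (q 0 * q 1 ^ 2 * p 2)) * X 1
       + C (-(p 1 * q 2) / (p 0 * q 0) + p 1 ^ 2 * q 2 ^ 2 / (q 0 ^ 2 * q 1 * p 2)) * X 0]

def phiLS₀ (p q : Fin 3 → ℂ) : Block :=
  !![C (1 / (q 0 ^ 2 * q 1 * p 2) - 1 / (p 0 * q 0 * p 1 * q 2)) * X 1
       + C (-p 0 ^ 2 / (q 0 ^ 3 * p 1 ^ 2 * p 2) + p 0 * q 1 / (q 0 ^ 2 * p 1 ^ 3 * q 2)) * X 0,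
     C (-1 / p 2 + p 0 ^ 2 * q 1 ^ 2 / (q 0 ^ 2 * p 1 ^ 2 * p 2));
     C (-p 0 / (p 1 * q 1 * q 2) + p 0 ^ 3 * q 1 / (q 0 ^ 2 * p 1 ^ 3 * q 2)) * X 1
       + C (p 1 / (p 0 * q 0 * q 2) - p 0 * q 1 ^ 2 / (q 0 ^ 3 * p 1 * q 2)) * X 0,
     C (-(q 1 * p 2) / (q 0 * p 1 ^ 2) + p 0 * q 2 / (q 0 ^ 2 * p 1))]

/-- The open string states that occur in the long-long-short correlators. -/
inductive OpenString
  | psiLL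
  | psiBarLL
  | phiLL
  | phiBarLL
  | psiLS
  | phiLS
  | psiSL
  | phiSL

namespace OpenString

/-- The brane on which a state begins. -/
def source : OpenString → Brane
  | psiSL | phiSL => .short
  | _ => .long

/-- The brane on which a state ends. -/
def target : OpenString → Brane
  | psiLS | phiLS => .short
  | _ => .long

/-- The `ℤ/2`-degree: `1` for fermions and `0` for bosons. -/
def degree : OpenString → ℕ
  | psiLL | psiBarLL | psiLS | psiSL => 1
  | phiLL | phiBarLL | phiLS | phiSL => 0

/-- The matrix of a state, without normalization. -/
def mat : OpenString → (Fin 3 → ℂ) → (Fin 3 → ℂ) → SuperMatrix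
  | psiLL, p, q =>
      let M := psiLL₀ q p
      oddMatrix (psiLL₀ p q) !![M 1 1, -M 0 1; -M 1 0, M 0 0]
  | psiBarLL, p, q =>
      let M := psiBarLL₀ q p
      oddMatrix (psiBarLL₀ p q) !![M 1 1, -M 0 1; -M 1 0, M 0 0]
  | phiLL, p, q =>
      let M := phiLL₀ p q
      evenMatrix M
        !![C (q 2 / p 2) * M 1 1, C (1 / (p 2 * q 2)) * M 1 0;
           C (p 2 * q 2) * M 0 1, C (p 2 / q 2) * M 0 0]
  | phiBarLL, p, q =>
      let M := phiBarLL₀ p q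
      evenMatrix M
        !![C (q 2 / p 2) * M 1 1, C (1 / (p 2 * q 2)) * M 1 0;
           C (p 2 * q 2) * M 0 1, C (p 2 / q 2) * M 0 0]
  | psiSL, p, q =>
      let M := psiSL₀ p q
      oddMatrix M
        !![-C (p 2 * q 2) * M 1 1, -C (p 2 / q 2) * M 1 0;
           C (q 2 / p 2) * M 0 1, C (1 / (p 2 * q 2)) * M 0 0]
  | phiSL, p, q =>
      let M := phiSL₀ p q
      evenMatrix M
        !![-C (p 2 * q 2) * M 1 1, -C (p 2 / q 2) * M 1 0;
           C (q 2 / p 2) * M 0 1, C (1 / (p 2 * q 2)) * M 0 0]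
  | psiLS, p, q =>
      let M := psiLS₀ p q
      oddMatrix M
        !![C (1 / (p 2 * q 2)) * M 1 1, -C (q 2 / p 2) * M 1 0;
           C (p 2 / q 2) * M 0 1, -C (p 2 * q 2) * M 0 0]
  | phiLS, p, q =>
      let M := phiLS₀ p q
      evenMatrix M
        !![-C (1 / (p 2 * q 2)) * M 1 1, C (q 2 / p 2) * M 1 0;
           -C (p 2 / q 2) * M 0 1, C (p 2 * q 2) * M 0 0]

/-- The physical state condition `Q_A Ψ - (-1)^|Ψ| Ψ Q_B = 0`. -/
def IsPhysical (s : OpenString) (p q : Fin 3 → ℂ) : Prop :=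
  s.source.Q p * s.mat p q - (-1) ^ s.degree • (s.mat p q * s.target.Q q) = 0

end OpenString

/-! ### The residue formula -/

def superTrace (M : SuperMatrix) : Poly := M.toBlocks₁₁.trace - M.toBlocks₂₂.trace

/-- `(∂Q)^{∧3} = (1/3!) ∑_σ (-1)^|σ| ∂_{σ(1)}Q ∂_{σ(2)}Q ∂_{σ(3)}Q`. -/
def wedgeDerivative (Q : SuperMatrix) : SuperMatrix :=
  (1 / 6 : ℂ) • ∑ σ : Equiv.Perm (Fin 3), (Equiv.Perm.sign σ : ℤ) •
    (Q.map (pderiv (σ 0)) * Q.map (pderiv (σ 1)) * Q.map (pderiv (σ 2)))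

/-- `r` is the Grothendieck residue at the origin
`(2πi)⁻³ ∮_{|fᵢ| = ε} h dx₁ dx₂ dx₃ / (f₁ f₂ f₃)` of polynomials `f₁, f₂, f₃` whose only common
zero is the origin. It is expressed through the transformation law, which also shows that the
residue does not depend on the choice of `n` and `A`: if `xᵢ^(nᵢ+1) = ∑ⱼ Aᵢⱼ fⱼ`, the residue of
`h / (f₁ f₂ f₃)` is that of `h det A / (x₁^(n₁+1) x₂^(n₂+1) x₃^(n₃+1))`, which is
the coefficient of `x₁^n₁ x₂^n₂ x₃^n₃` in `h det A`. -/
def IsGrothendieckResidue (f : Fin 3 → Poly) (h : Poly) (r : ℂ) : Prop :=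
  ∃ (n : Fin 3 →₀ ℕ) (A : Matrix (Fin 3) (Fin 3) Poly),
    (∀ i, (X i : Poly) ^ (n i + 1) = ∑ j, A i j * f j) ∧ r = coeff n (h * A.det)

/-- `r` is the value of the residue formula for the disk correlator of three boundary insertions,
`(2πi)⁻³ ∮ STr((∂Q)^{∧3} Ψ₁ Ψ₂ Ψ₃) d³x / (∂₁W ∂₂W ∂₃W)`. -/
def IsDiskCorrelator (W : Poly) (Q Ψ₁ Ψ₂ Ψ₃ : SuperMatrix) (r : ℂ) : Prop :=
  IsGrothendieckResidue (fun i => pderiv i W) (superTrace (wedgeDerivative Q * Ψ₁ * Ψ₂ * Ψ₃)) r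

/-- `r = ⟨Ψ₁(u₁,u₂) Ψ₂(u₂,u₃) Ψ₃(u₃,u₁)⟩`. -/
def IsThreePoint (τ : ℂ) (Ψ₁ Ψ₂ Ψ₃ : OpenString) (u₁ u₂ u₃ r : ℂ) : Prop :=
  IsDiskCorrelator (superpotential (bulkParam τ)) (Ψ₁.source.Q (alpha τ u₁))
    (Ψ₁.mat (alpha τ u₁) (alpha τ u₂)) (Ψ₂.mat (alpha τ u₂) (alpha τ u₃))
    (Ψ₃.mat (alpha τ u₃) (alpha τ u₁)) r

/-- The four pairs of long-long-short correlators; the letters give the statistics of the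
long-long, long-short and short-long insertion (`f` for fermion, `b` for boson). -/
inductive Sector
  | fff
  | fbb
  | bfb
  | bbf

namespace Sector

def longLong : Sector → OpenString
  | fff | fbb => .psiLL
  | bfb | bbf => .phiLL

/-- The second state between two long branes with the same statistics. -/
def longLongBar : Sector → OpenString
  | fff | fbb => .psiBarLL
  | bfb | bbf => .phiBarLL

def longShort : Sector → OpenString
  | fff | bfb => .psiLS
  | fbb | bbf => .phiLS

def shortLong : Sector → OpenString
  | fff | bbf => .psiSL
  | fbb | bfb => .phiSL

/-- The combination of boundary moduli on which the correlators of a sector depend. -/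
def modulus : Sector → ℂ → ℂ → ℂ → ℂ
  | fff, u₁, u₂, u₃ => u₁ + u₂ - u₃
  | fbb, u₁, u₂, u₃ => u₁ + u₂ + u₃
  | bfb, u₁, u₂, u₃ => u₁ - u₂ + u₃
  | bbf, u₁, u₂, u₃ => u₁ - u₂ - u₃

/-- For the A-branes `L₁, L₂, S₁` (in this order): `1` if the sector uses the brane,
`-1` if it uses the antibrane. -/
def orientation : Sector → Fin 3 → ℝ
  | fff => ![-1, 1, 1]
  | fbb => ![-1, 1, -1]
  | bfb => ![-1, -1, 1]
  | bbf => ![1, 1, 1]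

end Sector

/-! ### The A-model

The torus is the square torus `ℝ²/ℤ²`. The shift moduli `β = (β₁, β₂, β₃)` and the Wilson line
moduli `(α₁, α₂, α₃)` belong to the branes `L₁, L₂, S₁`, in this order. -/

/-- The lifts of the long brane `L₁`, with winding vector `(-1, 1)`. -/
def lineL1 (β : Fin 3 → ℝ) (m : ℤ) : Set (ℝ × ℝ) := {P | P.2 = -P.1 + β 0 + m}

/-- The lifts of the long brane `L₂`, with winding vector `(1, 1)`. -/
def lineL2 (β : Fin 3 → ℝ) (m : ℤ) : Set (ℝ × ℝ) := {P | P.2 = P.1 + β 1 + m}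

/-- The lifts of the short brane `S₁`, with winding vector `(0, -1)`. -/
def lineS1 (β : Fin 3 → ℝ) (m : ℤ) : Set (ℝ × ℝ) := {P | P.1 = β 2 / 2 + m}

/-- The vertices of the instanton with lattice shift `k`: the triangle in `ℝ²` enclosed by the
lifts `0`, `k`, `0` of `L₁`, `L₂`, `S₁`. Up to translations by `ℤ²` every triangle enclosed by
lifts of the three branes is one of these, for exactly one `k`. The parity of `k` tells in which of
their two intersection points on the torus `L₁` and `L₂` meet. -/
def vertexL1L2 (β : Fin 3 → ℝ) (k : ℤ) : ℝ × ℝ := ((β 0 - β 1 - k) / 2, (β 0 + β 1 + k) / 2)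

def vertexL2S1 (β : Fin 3 → ℝ) (k : ℤ) : ℝ × ℝ := (β 2 / 2, β 2 / 2 + β 1 + k)

def vertexS1L1 (β : Fin 3 → ℝ) (_k : ℤ) : ℝ × ℝ := (β 2 / 2, -(β 2 / 2) + β 0)

theorem vertices_mem (β : Fin 3 → ℝ) (k : ℤ) :
    vertexL1L2 β k ∈ lineL1 β 0 ∩ lineL2 β k ∧ vertexL2S1 β k ∈ lineL2 β k ∩ lineS1 β 0 ∧
      vertexS1L1 β k ∈ lineS1 β 0 ∩ lineL1 β 0 := by
  refine ⟨⟨?_, ?_⟩, ⟨?_, ?_⟩, ⟨?_, ?_⟩⟩ <;>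
    simp only [lineL1, lineL2, lineS1, vertexL1L2, vertexL2S1, vertexS1L1, Set.mem_ofPred_eq] <;>
    push_cast <;> ring

/-- Every triple of lifts can be moved by a lattice translation `(x, y)` to lifts
`0`, `k`, `0`, and `k` is determined by the triple. -/
theorem lifts_translate (β : Fin 3 → ℝ) (m₁ m₂ m₃ : ℤ) :
    ∃! k : ℤ, ∃ x y : ℤ, ∀ P : ℝ × ℝ,
      (P ∈ lineL1 β m₁ ↔ (P.1 + x, P.2 + y) ∈ lineL1 β 0) ∧
      (P ∈ lineL2 β m₂ ↔ (P.1 + x, P.2 + y) ∈ lineL2 β k) ∧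
      (P ∈ lineS1 β m₃ ↔ (P.1 + x, P.2 + y) ∈ lineS1 β 0) := by
  have key : ∀ k : ℤ, (∃ x y : ℤ, ∀ P : ℝ × ℝ,
      (P ∈ lineL1 β m₁ ↔ (P.1 + x, P.2 + y) ∈ lineL1 β 0) ∧
      (P ∈ lineL2 β m₂ ↔ (P.1 + x, P.2 + y) ∈ lineL2 β k) ∧
      (P ∈ lineS1 β m₃ ↔ (P.1 + x, P.2 + y) ∈ lineS1 β 0)) → k = m₂ - m₁ + 2 * m₃ := by
    rintro k ⟨x, y, h⟩
    have h1 := (h (0, β 0 + m₁)).1.1 (by simp [lineL1])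
    have h2 := (h (0, β 1 + m₂)).2.1.1 (by simp [lineL2])
    have h3 := (h (β 2 / 2 + m₃, 0)).2.2.1 (by simp [lineS1])
    simp only [lineL1, lineL2, lineS1, Set.mem_ofPred_eq] at h1 h2 h3
    push_cast at h1 h2 h3
    have : (k : ℝ) = m₂ - m₁ + 2 * m₃ := by linarith
    exact_mod_cast this
  refine ⟨m₂ - m₁ + 2 * m₃, ⟨-m₃, m₃ - m₁, fun P => ?_⟩, key⟩
  simp only [lineL1, lineL2, lineS1, Set.mem_ofPred_eq]
  push_cast
  refine ⟨⟨fun h => ?_, fun h => ?_⟩, ⟨fun h => ?_, fun h => ?_⟩, ⟨fun h => ?_, fun h => ?_⟩⟩ <;>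
    linarith

/-- The area of the triangle with vertices `P`, `Q`, `R`. -/
def triangleArea (P Q R : ℝ × ℝ) : ℝ :=
  |(Q.1 - P.1) * (R.2 - P.2) - (Q.2 - P.2) * (R.1 - P.1)| / 2

/-- The area of the instanton, in units of the area `1` of the torus. -/
def instantonArea (β : Fin 3 → ℝ) (k : ℤ) : ℝ :=
  triangleArea (vertexL1L2 β k) (vertexL2S1 β k) (vertexS1L1 β k)

/-- The signed length of the side from `P` to `Q`, in units of the winding vector `w` of the brane
on which the side lies. -/
def windingLength (w P Q : ℝ × ℝ) : ℝ :=
  ((Q.1 - P.1) * w.1 + (Q.2 - P.2) * w.2) / (w.1 ^ 2 + w.2 ^ 2)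

/-- The Wilson line phase of the instanton in a given sector: the integral of the flat connections
along its boundary. The holonomies of `L₁`, `L₂`, `S₁` are `α₁`, `α₂`, `α₃ / 2`
(just as the position of `S₁` is `β₃ / 2`), with the opposite sign for antibranes. -/
def instantonPhase (α β : Fin 3 → ℝ) (s : Sector) (k : ℤ) : ℝ :=
  s.orientation 1 * α 1 * windingLength (1, 1) (vertexL1L2 β k) (vertexL2S1 β k) +
  s.orientation 2 * (α 2 / 2) * windingLength (0, -1) (vertexL2S1 β k) (vertexS1L1 β k) +
  s.orientation 0 * α 0 * windingLength (-1, 1) (vertexS1L1 β k) (vertexL1L2 β k)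

/-- The contribution `e^(2πiτA) e^(2πiW)` of an instanton to the A-model three-point function. -/
def instantonTerm (τ : ℂ) (α β : Fin 3 → ℝ) (s : Sector) (k : ℤ) : ℂ :=
  Complex.exp (2 * Real.pi * Complex.I * τ * instantonArea β k) *
    Complex.exp (2 * Real.pi * Complex.I * instantonPhase α β s k)

/-- `β = -β₁ + β₂ + β₃`. -/
def totalShift (β : Fin 3 → ℝ) : ℝ := -β 0 + β 1 + β 2

/-- The sum of the Wilson line moduli, with the sign `-1` for antibranes. -/
def totalWilson (α : Fin 3 → ℝ) (s : Sector) : ℝ := ∑ i, s.orientation i * α i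

/-- The mirror map `2u = βτ + α`. -/
def mirrorModulus (τ : ℂ) (α β : Fin 3 → ℝ) (s : Sector) : ℂ :=
  (totalShift β * τ + totalWilson α s) / 2

/-- The factor `e^(2πiτβ²/4) e^(2πiβα/2)`, not holomorphic in `2u = βτ + α`, which is split off
from the A-model three-point functions. -/
def anomalyFactor (τ : ℂ) (α β : Fin 3 → ℝ) (s : Sector) : ℂ :=
  Complex.exp (2 * Real.pi * Complex.I * τ * ((totalShift β : ℂ) ^ 2 / 4)) *
    Complex.exp (2 * Real.pi * Complex.I * ((totalShift β : ℂ) * totalWilson α s / 2))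

/-- The summand of the instanton sum `Δ = ∑ₙ q^((n+1/2)²) e^(2πi(n+1/2)2u)`, `q = e^(2πiτ)`. -/
def deltaTerm (τ u : ℂ) (n : ℤ) : ℂ :=
  Complex.exp (2 * Real.pi * Complex.I * τ * ((n : ℂ) + 1 / 2) ^ 2) *
    Complex.exp (2 * Real.pi * Complex.I * ((n : ℂ) + 1 / 2) * (2 * u))

/-- The summand of the instanton sum `Δ̄ = ∑ₙ q^(n²) e^(2πi 2un)`. -/
def deltaBarTerm (τ u : ℂ) (n : ℤ) : ℂ :=
  Complex.exp (2 * Real.pi * Complex.I * τ * (n : ℂ) ^ 2) *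
    Complex.exp (2 * Real.pi * Complex.I * (2 * u) * n)

/-- The holomorphic A-model three-point function `Δ` of a sector. -/
def delta (τ : ℂ) (α β : Fin 3 → ℝ) (s : Sector) : ℂ :=
  ∑' n, deltaTerm τ (mirrorModulus τ α β s) n

/-- The holomorphic A-model three-point function `Δ̄` of a sector. -/
def deltaBar (τ : ℂ) (α β : Fin 3 → ℝ) (s : Sector) : ℂ :=
  ∑' n, deltaBarTerm τ (mirrorModulus τ α β s) n

/-- The mirror dictionary between the A-model moduli of `L₂, L₁, S₁` and the B-model boundary
moduli `u₁, u₂, u₃` in a sector, with the Wilson lines corresponding as `2u₁ ↔ α₂`,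
`2u₂ ↔ -α₁`, `2u₃ ↔ -α₃`. The `δᵢ` are shifts of the origin. -/
def mirrorBoundaryModuli (τ : ℂ) (α β : Fin 3 → ℝ) (s : Sector) (δ : Fin 3 → ℂ) : Fin 3 → ℂ :=
  ![(α 1 + s.orientation 1 * β 1 * τ) / 2 + δ 0,
    (-α 0 + s.orientation 0 * β 0 * τ) / 2 + δ 1,
    (-α 2 - s.orientation 2 * β 2 * τ) / 2 + δ 2]

/-- The shifts of the origin add up to the half-period shift `2u ↦ 2u + 1/2` of the theta
argument. -/
def IsHalfPeriodShift (s : Sector) (δ : Fin 3 → ℂ) : Prop :=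
  2 * (s.orientation 1 * δ 0 - s.orientation 0 * δ 1 - s.orientation 2 * δ 2) = 1 / 2

end QuarticTorus

end

/-!
# Long-long-short correlators on the quartic torus

The correlators of the B-model are theta functions because of one product formula: `Θ(a,τ) Θ(b,τ)`
is a sum of two products of theta functions of modulus `2τ` at `a + b` and `a - b`
(`thetaChar_mul_thetaChar`). It makes every bilinear or quartic relation a polynomial identity.
Three kinds of relations are needed, all for the modulus `2τ`:

* the curve `α₁⁴ + α₂⁴ - α₃² - a α₁² α₂² = 0` (`theta_quartic`, `alpha_curve`), which gives
  `Q² = W` and, through the difference of the curve equations of the two branes, the physical state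
  condition (`commutator_eq_defect`);
* the addition formulas for `θᵢ(x + y) θⱼ(x - y)` with `i, j ∈ {1, 4}`, where `p` and `q` stand for
  the `α`'s at `x/2` and `y/2` (`alpha_add_sub_one_four` and the lemmas after it). The coefficients
  of a state matrix are monomials times two of the polynomials `p₃q₁q₂ ± q₃p₁p₂`,
  `p₂²q₂² - p₁²q₁²`, `p₁²q₂² - p₂²q₁²`, and by the addition formulas these two have a common factor
  `θ(x ± y)`. This factor, divided by the common denominator of the matrix, is the main part of the
  normalization factor (`OpenString.norm`). What remains is linear in `θ₁` and `θ₄` at the other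
  combination `x ∓ y`; these two never vanish together, so a state matrix is zero exactly when its
  normalization factor is;
* the Riemann relations for three arguments (`riemann_relation_one_same` and its variants), whose
  right-hand sides contain `θ₁(x + y + z)` or `θ₄(x + y + z)`.

Since the socle of the Jacobian ring of `W` is in degree four, the residue is a combination of the
coefficients of `x₁⁴`, `x₂⁴` and `x₁²x₂²` of the supertrace
(`isGrothendieckResidue_superpotential`). For the rescaled states all eight numerators have the
same form, bilinear in `θ(x + y)` and in the left-hand sides of two Riemann relations
(`numeratorForm`). Riemann relations, addition formulas and the curve equation then collapse it to a
monomial times `a² - 4`, which the residue cancels, and the expected theta function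
(`numeratorForm_eq`). The four sectors differ by the signs of the second and the third modulus.

On the A-side the triangle with lattice shift `k` has area `(β + k)²/4` and Wilson line phase
`α (β + k)/2`; expanding the square gives the theta series of `Δ` and `Δ̄` times the anomalous
factor. The two sides agree because the mirror dictionary turns the modulus of the correlator into
`±(2u + 1/2)`, and the shift by `1/2` turns `θ₁, θ₄` into `-θ₂, θ₃`.
-/

noncomputable section

namespace QuarticTorus

open MvPolynomial Matrix

/-! ### Theta functions with characteristics -/

/-- The summand of `thetaChar`. -/
def thetaTerm (c₁ c₂ : ℝ) (u τ : ℂ) (m : ℤ) : ℂ :=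
  Complex.exp (2 * Real.pi * Complex.I * τ * (((m : ℂ) + c₁) ^ 2 / 2)) *
    Complex.exp (2 * Real.pi * Complex.I * (u + c₂) * ((m : ℂ) + c₁))

/-- The factor that relates a theta function with characteristics to `jacobiTheta₂`. -/
def thetaPrefactor (c₁ c₂ : ℝ) (u τ : ℂ) : ℂ :=
  Complex.exp (Real.pi * Complex.I * τ * c₁ ^ 2 + 2 * Real.pi * Complex.I * (u + c₂) * c₁)

lemma thetaTerm_eq (c₁ c₂ : ℝ) (u τ : ℂ) (m : ℤ) :
    thetaTerm c₁ c₂ u τ m =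
      thetaPrefactor c₁ c₂ u τ * jacobiTheta₂_term m (u + c₂ + c₁ * τ) τ := by
  rw [thetaTerm, thetaPrefactor, jacobiTheta₂_term, ← Complex.exp_add, ← Complex.exp_add]
  congr 1
  ring

lemma summable_thetaTerm (c₁ c₂ : ℝ) (u : ℂ) {τ : ℂ} (hτ : 0 < τ.im) :
    Summable (thetaTerm c₁ c₂ u τ) := by
  simp_rw [funext (thetaTerm_eq c₁ c₂ u τ)]
  exact ((summable_jacobiTheta₂_term_iff _ _).2 hτ).mul_left _

lemma hasSum_thetaChar (c₁ c₂ : ℝ) (u : ℂ) {τ : ℂ} (hτ : 0 < τ.im) :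
    HasSum (thetaTerm c₁ c₂ u τ) (thetaChar c₁ c₂ u τ) :=
  (summable_thetaTerm c₁ c₂ u hτ).hasSum

lemma thetaChar_eq (c₁ c₂ : ℝ) (u τ : ℂ) :
    thetaChar c₁ c₂ u τ =
      thetaPrefactor c₁ c₂ u τ * jacobiTheta₂ (u + c₂ + c₁ * τ) τ := by
  rw [jacobiTheta₂, ← tsum_mul_left]
  exact tsum_congr (thetaTerm_eq c₁ c₂ u τ)

lemma differentiable_thetaChar (c₁ c₂ : ℝ) {τ : ℂ} (hτ : 0 < τ.im) :
    Differentiable ℂ fun u => thetaChar c₁ c₂ u τ := by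
  simp_rw [thetaChar_eq]
  refine Differentiable.mul (by unfold thetaPrefactor; fun_prop) fun u => ?_
  exact (differentiableAt_jacobiTheta₂_fst _ hτ).comp u
    (f := fun u : ℂ => u + c₂ + c₁ * τ) (by fun_prop)

lemma thetaChar_neg (c₁ c₂ : ℝ) (u τ : ℂ) :
    thetaChar (-c₁) (-c₂) (-u) τ = thetaChar c₁ c₂ u τ := by
  rw [thetaChar, thetaChar, ← (Equiv.neg ℤ).tsum_eq]
  refine tsum_congr fun m => ?_
  simp only [Equiv.neg_apply]
  push_cast
  congr 2 <;> ring

lemma thetaChar_add_one_left (c₁ c₂ : ℝ) (u τ : ℂ) :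
    thetaChar (c₁ + 1) c₂ u τ = thetaChar c₁ c₂ u τ := by
  rw [thetaChar, thetaChar, ← (Equiv.addRight (1 : ℤ)).tsum_eq
    (fun m : ℤ => Complex.exp (2 * Real.pi * Complex.I * τ * (((m : ℂ) + c₁) ^ 2 / 2)) *
    Complex.exp (2 * Real.pi * Complex.I * (u + c₂) * ((m : ℂ) + c₁)))]
  refine tsum_congr fun m => ?_
  simp only [Equiv.coe_addRight]
  push_cast
  congr 2 <;> ring

lemma thetaChar_add_one_right (c₁ c₂ : ℝ) (u τ : ℂ) :
    thetaChar c₁ (c₂ + 1) u τ =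
      Complex.exp (2 * Real.pi * Complex.I * c₁) * thetaChar c₁ c₂ u τ := by
  rw [thetaChar, thetaChar, ← tsum_mul_left]
  refine tsum_congr fun m => ?_
  have h : Complex.exp (m * (2 * Real.pi * Complex.I)) = 1 := Complex.exp_int_mul_two_pi_mul_I m
  rw [← Complex.exp_add, ← Complex.exp_add, ← Complex.exp_add,
    ← mul_one (Complex.exp (2 * Real.pi * Complex.I * c₁ + _)), ← h, ← Complex.exp_add]
  congr 1
  push_cast
  ring

/-- The map `(K, L, j) ↦ (K + L + j, K - L)` that sorts the pairs `(m, n)` of integers by the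
parity `j` of `m + n`. -/
def paritySplit : (ℤ × ℤ) ⊕ (ℤ × ℤ) ≃ ℤ × ℤ where
  toFun := Sum.elim (fun k => (k.1 + k.2, k.1 - k.2)) (fun k => (k.1 + k.2 + 1, k.1 - k.2))
  invFun m := if (m.1 + m.2) % 2 = 0 then .inl ((m.1 + m.2) / 2, (m.1 - m.2) / 2)
    else .inr ((m.1 + m.2) / 2, (m.1 - m.2) / 2)
  left_inv k := by
    rcases k with ⟨K, L⟩ | ⟨K, L⟩
    · have h : (K + L + (K - L)) % 2 = 0 := by omega
      simp only [Sum.elim_inl, h, if_true, Sum.inl.injEq, Prod.mk.injEq]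
      omega
    · have h : ¬ (K + L + 1 + (K - L)) % 2 = 0 := by omega
      simp only [Sum.elim_inr, h, if_false, Sum.inr.injEq, Prod.mk.injEq]
      omega
  right_inv m := by
    rcases m with ⟨m, n⟩
    by_cases h : (m + n) % 2 = 0
    · simp only [h, if_true, Sum.elim_inl, Prod.mk.injEq]
      omega
    · simp only [h, if_false, Sum.elim_inr, Prod.mk.injEq]
      omega

/-- Two theta functions of modulus `τ` multiply to a sum of two products of theta functions of
modulus `2τ`, in the sum and the difference of the arguments. All bilinear and quartic relations
used below follow from this one by algebra. -/
theorem thetaChar_mul_thetaChar (c₁ c₂ d₁ d₂ : ℝ) (a b : ℂ) {τ : ℂ} (hτ : 0 < τ.im) :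
    thetaChar c₁ c₂ a τ * thetaChar d₁ d₂ b τ =
      thetaChar ((c₁ + d₁) / 2) (c₂ + d₂) (a + b) (2 * τ) *
          thetaChar ((c₁ - d₁) / 2) (c₂ - d₂) (a - b) (2 * τ) +
        thetaChar ((c₁ + d₁) / 2 + 1 / 2) (c₂ + d₂) (a + b) (2 * τ) *
          thetaChar ((c₁ - d₁) / 2 + 1 / 2) (c₂ - d₂) (a - b) (2 * τ) := by
  have h2 : 0 < (2 * τ).im := by simpa using hτ
  have hs : ∀ (c₁ c₂ d₁ d₂ : ℝ) (a b : ℂ) {τ : ℂ}, 0 < τ.im →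
      HasSum (fun k : ℤ × ℤ => thetaTerm c₁ c₂ a τ k.1 * thetaTerm d₁ d₂ b τ k.2)
        (thetaChar c₁ c₂ a τ * thetaChar d₁ d₂ b τ) := fun c₁ c₂ d₁ d₂ a b τ h =>
    (hasSum_thetaChar c₁ c₂ a h).mul (hasSum_thetaChar d₁ d₂ b h)
      (summable_mul_of_summable_norm (summable_thetaTerm c₁ c₂ a h).norm
        (summable_thetaTerm d₁ d₂ b h).norm)
  have h := paritySplit.hasSum_iff.2 (hs c₁ c₂ d₁ d₂ a b hτ)
  refine h.unique (HasSum.sum ?_ ?_)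
  · convert hs ((c₁ + d₁) / 2) (c₂ + d₂) ((c₁ - d₁) / 2) (c₂ - d₂) (a + b) (a - b) h2
      using 2 with k
    simp only [Function.comp, paritySplit, Equiv.coe_fn_mk, Sum.elim_inl, thetaTerm,
      ← Complex.exp_add]
    congr 1
    push_cast
    ring
  · convert hs ((c₁ + d₁) / 2 + 1 / 2) (c₂ + d₂) ((c₁ - d₁) / 2 + 1 / 2) (c₂ - d₂)
      (a + b) (a - b) h2 using 2 with k
    simp only [Function.comp, paritySplit, Equiv.coe_fn_mk, Sum.elim_inr, thetaTerm,
      ← Complex.exp_add]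
    congr 1
    push_cast
    ring

/-! ### The four theta functions -/

lemma exp_two_pi_I_half : Complex.exp (2 * Real.pi * Complex.I * ((1 / 2 : ℝ) : ℂ)) = -1 := by
  refine Eq.trans (congrArg Complex.exp ?_) Complex.exp_pi_mul_I
  push_cast
  ring

lemma exp_two_pi_I_quarter :
    Complex.exp (2 * Real.pi * Complex.I * ((1 / 4 : ℝ) : ℂ)) = Complex.I := by
  refine Eq.trans (congrArg Complex.exp ?_) Complex.exp_pi_div_two_mul_I
  push_cast
  ring

lemma Theta2_neg (u τ : ℂ) : Theta2 (-u) τ = Theta2 u τ := by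
  have h := thetaChar_neg (1 / 2) 0 u τ
  have h' := thetaChar_add_one_left (-(1 / 2)) 0 (-u) τ
  norm_num at h h'
  rw [Theta2, Theta2, h', h]

lemma Theta3_neg (u τ : ℂ) : Theta3 (-u) τ = Theta3 u τ := by
  simpa [Theta3] using thetaChar_neg 0 0 u τ

lemma Theta4_neg (u τ : ℂ) : Theta4 (-u) τ = Theta4 u τ := by
  have h := thetaChar_neg 0 (1 / 2) u τ
  have h' := thetaChar_add_one_right 0 (-(1 / 2)) (-u) τ
  norm_num at h h'
  rw [Theta4, Theta4, h', h]

lemma Theta1_neg (u τ : ℂ) : Theta1 (-u) τ = -Theta1 u τ := by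
  have h := thetaChar_neg (1 / 2) (1 / 2) u τ
  have h' := thetaChar_add_one_left (-(1 / 2)) (-(1 / 2)) (-u) τ
  have h'' := thetaChar_add_one_right (1 / 2) (-(1 / 2)) (-u) τ
  rw [exp_two_pi_I_half] at h''
  norm_num at h h' h''
  rw [Theta1, Theta1, h'', h', h]

lemma Theta1_add_half (z τ : ℂ) : Theta1 (z + 1 / 2) τ = -Theta2 z τ := by
  have h := thetaChar_add_one_right (1 / 2) 0 z τ
  rw [exp_two_pi_I_half, neg_one_mul] at h
  rw [Theta1, Theta2, ← h, thetaChar, thetaChar]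
  refine tsum_congr fun m => ?_
  congr 2
  push_cast
  ring

lemma Theta4_add_half (z τ : ℂ) : Theta4 (z + 1 / 2) τ = Theta3 z τ := by
  have h := thetaChar_add_one_right 0 0 z τ
  simp only [Complex.ofReal_zero, mul_zero, Complex.exp_zero, one_mul] at h
  rw [Theta4, Theta3, ← h, thetaChar, thetaChar]
  refine tsum_congr fun m => ?_
  congr 2
  push_cast
  ring

lemma differentiable_Theta1 {τ : ℂ} (hτ : 0 < τ.im) : Differentiable ℂ (Theta1 · τ) :=
  differentiable_thetaChar _ _ hτ

lemma differentiable_Theta2 {τ : ℂ} (hτ : 0 < τ.im) : Differentiable ℂ (Theta2 · τ) :=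
  differentiable_thetaChar _ _ hτ

lemma differentiable_Theta3 {τ : ℂ} (hτ : 0 < τ.im) : Differentiable ℂ (Theta3 · τ) :=
  differentiable_thetaChar _ _ hτ

lemma differentiable_Theta4 {τ : ℂ} (hτ : 0 < τ.im) : Differentiable ℂ (Theta4 · τ) :=
  differentiable_thetaChar _ _ hτ

/-! ### Product and addition formulas -/

section Products

variable {τ : ℂ} (hτ : 0 < τ.im)
include hτ

lemma Theta3_mul_Theta3 (a b : ℂ) : Theta3 a τ * Theta3 b τ =
    Theta3 (a + b) (2 * τ) * Theta3 (a - b) (2 * τ) +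
      Theta2 (a + b) (2 * τ) * Theta2 (a - b) (2 * τ) := by
  have h := thetaChar_mul_thetaChar 0 0 0 0 a b hτ
  norm_num at h
  simpa only [Theta3, Theta2] using h

lemma Theta4_mul_Theta4 (a b : ℂ) : Theta4 a τ * Theta4 b τ =
    Theta3 (a + b) (2 * τ) * Theta3 (a - b) (2 * τ) -
      Theta2 (a + b) (2 * τ) * Theta2 (a - b) (2 * τ) := by
  have h := thetaChar_mul_thetaChar 0 (1 / 2) 0 (1 / 2) a b hτ
  have h0 := thetaChar_add_one_right 0 0 (a + b) (2 * τ)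
  have h1 := thetaChar_add_one_right (1 / 2) 0 (a + b) (2 * τ)
  rw [exp_two_pi_I_half] at h1
  norm_num at h h0 h1
  simp only [Theta4, Theta3, Theta2, h, h0, h1]
  ring

lemma Theta2_mul_Theta2 (a b : ℂ) : Theta2 a τ * Theta2 b τ =
    Theta2 (a + b) (2 * τ) * Theta3 (a - b) (2 * τ) +
      Theta3 (a + b) (2 * τ) * Theta2 (a - b) (2 * τ) := by
  have h := thetaChar_mul_thetaChar (1 / 2) 0 (1 / 2) 0 a b hτ
  have h0 := thetaChar_add_one_left 0 0 (a + b) (2 * τ)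
  norm_num at h h0
  simp only [Theta3, Theta2, h, h0]

lemma Theta1_mul_Theta1 (a b : ℂ) : Theta1 a τ * Theta1 b τ =
    Theta3 (a + b) (2 * τ) * Theta2 (a - b) (2 * τ) -
      Theta2 (a + b) (2 * τ) * Theta3 (a - b) (2 * τ) := by
  have h := thetaChar_mul_thetaChar (1 / 2) (1 / 2) (1 / 2) (1 / 2) a b hτ
  have h0 := thetaChar_add_one_right 0 0 (a + b) (2 * τ)
  have h1 := thetaChar_add_one_right (1 / 2) 0 (a + b) (2 * τ)
  have h2 := thetaChar_add_one_left 0 1 (a + b) (2 * τ)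
  rw [exp_two_pi_I_half] at h1
  norm_num at h h0 h1 h2
  simp only [Theta1, Theta3, Theta2, h, h0, h1, h2]
  ring

lemma Theta2_mul_Theta3 (a b : ℂ) : Theta2 a τ * Theta3 b τ =
    thetaChar (1 / 4) 0 (a + b) (2 * τ) * thetaChar (1 / 4) 0 (a - b) (2 * τ) +
      thetaChar (1 / 4) 0 (-(a + b)) (2 * τ) * thetaChar (1 / 4) 0 (-(a - b)) (2 * τ) := by
  have h := thetaChar_mul_thetaChar (1 / 2) 0 0 0 a b hτ
  have h0 := fun w => thetaChar_add_one_left (-(1 / 4)) 0 w (2 * τ)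
  have h1 := fun w => thetaChar_neg (1 / 4) 0 (-w) (2 * τ)
  norm_num only at h h0 h1
  simp only [neg_neg] at h1
  rw [Theta2, Theta3]
  norm_num only
  rw [h, h0, h0, h1, h1]

lemma Theta1_mul_Theta4 (a b : ℂ) : Theta1 a τ * Theta4 b τ = Complex.I *
    (thetaChar (1 / 4) 0 (a + b) (2 * τ) * thetaChar (1 / 4) 0 (a - b) (2 * τ) -
      thetaChar (1 / 4) 0 (-(a + b)) (2 * τ) * thetaChar (1 / 4) 0 (-(a - b)) (2 * τ)) := by
  have h := thetaChar_mul_thetaChar (1 / 2) (1 / 2) 0 (1 / 2) a b hτ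
  have h0 := fun w => thetaChar_add_one_left (-(1 / 4)) 0 w (2 * τ)
  have h1 := fun w => thetaChar_neg (1 / 4) 0 (-w) (2 * τ)
  have h2 := thetaChar_add_one_right (1 / 4) 0 (a + b) (2 * τ)
  have h3 := thetaChar_add_one_right (3 / 4) 0 (a + b) (2 * τ)
  have h4 : Complex.exp (2 * Real.pi * Complex.I * ((3 / 4 : ℝ) : ℂ)) = -Complex.I := by
    rw [show 2 * Real.pi * Complex.I * ((3 / 4 : ℝ) : ℂ) =
      2 * Real.pi * Complex.I * ((1 / 2 : ℝ) : ℂ) +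
        2 * Real.pi * Complex.I * ((1 / 4 : ℝ) : ℂ) by push_cast; ring, Complex.exp_add,
      exp_two_pi_I_half, exp_two_pi_I_quarter]
    ring
  rw [exp_two_pi_I_quarter] at h2
  rw [h4] at h3
  norm_num only at h h0 h1 h2 h3
  simp only [neg_neg] at h1
  rw [Theta1, Theta4]
  norm_num only
  rw [h, h2, h3, h0, h0, h1, h1]
  ring

lemma Theta1_mul_Theta1_add_sub (x y : ℂ) :
    Theta4 0 τ ^ 2 * (Theta1 (x + y) τ * Theta1 (x - y) τ) =
      Theta1 x τ ^ 2 * Theta4 y τ ^ 2 - Theta4 x τ ^ 2 * Theta1 y τ ^ 2 := by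
  have e0 := Theta4_mul_Theta4 hτ 0 0
  have e1 := Theta1_mul_Theta1 hτ (x + y) (x - y)
  have e2 := Theta1_mul_Theta1 hτ x x
  have e3 := Theta1_mul_Theta1 hτ y y
  have e4 := Theta4_mul_Theta4 hτ x x
  have e5 := Theta4_mul_Theta4 hτ y y
  rw [show x + y + (x - y) = x + x by ring, show x + y - (x - y) = y + y by ring] at e1
  rw [sub_self] at e0 e2 e3 e4 e5
  rw [add_zero] at e0
  simp only [pow_two, e0, e1, e2, e3, e4, e5]
  ring

lemma Theta4_mul_Theta4_add_sub (x y : ℂ) :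
    Theta4 0 τ ^ 2 * (Theta4 (x + y) τ * Theta4 (x - y) τ) =
      Theta4 x τ ^ 2 * Theta4 y τ ^ 2 - Theta1 x τ ^ 2 * Theta1 y τ ^ 2 := by
  have e0 := Theta4_mul_Theta4 hτ 0 0
  have e1 := Theta4_mul_Theta4 hτ (x + y) (x - y)
  have e2 := Theta1_mul_Theta1 hτ x x
  have e3 := Theta1_mul_Theta1 hτ y y
  have e4 := Theta4_mul_Theta4 hτ x x
  have e5 := Theta4_mul_Theta4 hτ y y
  rw [show x + y + (x - y) = x + x by ring, show x + y - (x - y) = y + y by ring] at e1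
  rw [sub_self] at e0 e2 e3 e4 e5
  rw [add_zero] at e0
  simp only [pow_two, e0, e1, e2, e3, e4, e5]
  ring

lemma Theta1_mul_Theta4_add_sub (x y : ℂ) :
    Theta2 0 τ * Theta3 0 τ * (Theta1 (x + y) τ * Theta4 (x - y) τ) =
      Theta2 x τ * Theta3 x τ * (Theta1 y τ * Theta4 y τ) +
        Theta2 y τ * Theta3 y τ * (Theta1 x τ * Theta4 x τ) := by
  have e0 := Theta2_mul_Theta3 hτ 0 0
  have e1 := Theta1_mul_Theta4 hτ (x + y) (x - y)
  have e2 := Theta1_mul_Theta4 hτ x x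
  have e3 := Theta1_mul_Theta4 hτ y y
  have e4 := Theta2_mul_Theta3 hτ x x
  have e5 := Theta2_mul_Theta3 hτ y y
  rw [show x + y + (x - y) = x + x by ring, show x + y - (x - y) = y + y by ring] at e1
  rw [sub_self] at e0 e2 e3 e4 e5
  rw [add_zero] at e0
  simp only [e0, e1, e2, e3, e4, e5, neg_zero]
  ring

/-- The quartic relation between the squares of the theta functions: `θ₁, θ₄, θ₂θ₃`
parametrize the boundary moduli space. -/
lemma theta_quartic (x : ℂ) :
    Theta2 0 τ ^ 2 * Theta3 0 τ ^ 2 * (Theta1 x τ ^ 4 + Theta4 x τ ^ 4) =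
      Theta4 0 τ ^ 4 * (Theta2 x τ ^ 2 * Theta3 x τ ^ 2) +
        (Theta2 0 τ ^ 4 + Theta3 0 τ ^ 4) * (Theta1 x τ ^ 2 * Theta4 x τ ^ 2) := by
  have a2 := Theta2_mul_Theta2 hτ 0 0
  have a3 := Theta3_mul_Theta3 hτ 0 0
  have a4 := Theta4_mul_Theta4 hτ 0 0
  have e1 := Theta1_mul_Theta1 hτ x x
  have e2 := Theta2_mul_Theta2 hτ x x
  have e3 := Theta3_mul_Theta3 hτ x x
  have e4 := Theta4_mul_Theta4 hτ x x
  rw [sub_self] at a2 a3 a4 e1 e2 e3 e4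
  rw [add_zero] at a2 a3 a4
  rw [← pow_two] at a2 a3 a4 e1 e2 e3 e4
  have h4 : ∀ z : ℂ, z ^ 4 = (z ^ 2) ^ 2 := fun z => by ring
  simp only [h4, a2, a3, a4, e1, e2, e3, e4]
  ring

lemma Theta3_zero_pow_four :
    Theta3 0 τ ^ 4 = Theta2 0 τ ^ 4 + Theta4 0 τ ^ 4 := by
  have a2 := Theta2_mul_Theta2 hτ 0 0
  have a3 := Theta3_mul_Theta3 hτ 0 0
  have a4 := Theta4_mul_Theta4 hτ 0 0
  rw [sub_self, add_zero, ← pow_two] at a2 a3 a4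
  have h4 : ∀ z : ℂ, z ^ 4 = (z ^ 2) ^ 2 := fun z => by ring
  simp only [h4, a2, a3, a4]
  ring

/-- A quartic Riemann relation for three independent arguments; the three relations that follow
are its images under half-period shifts. In each proof the four factors are paired so that the
product formula leads to the same arguments on both sides. -/
lemma riemann_relation_one_same (x y z : ℂ) :
    Theta4 x τ * Theta4 y τ * (Theta1 (y + z) τ * Theta1 (z + x) τ) -
      Theta1 x τ * Theta1 y τ * (Theta4 (y + z) τ * Theta4 (z + x) τ) =
    Theta4 0 τ * Theta1 (x + y + z) τ * (Theta1 z τ * Theta4 (x - y) τ) := by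
  have e1 := Theta4_mul_Theta4 hτ x y
  have e2 := Theta1_mul_Theta1 hτ (y + z) (z + x)
  have e3 := Theta1_mul_Theta1 hτ x y
  have e4 := Theta4_mul_Theta4 hτ (y + z) (z + x)
  have e5 := Theta1_mul_Theta1 hτ (x + y + z) z
  have e6 := Theta4_mul_Theta4 hτ (x - y) 0
  rw [show y + z + (z + x) = x + y + z + z by ring, show y + z - (z + x) = -(x - y) by ring,
    Theta2_neg, Theta3_neg] at e2 e4
  rw [add_sub_cancel_right] at e5
  rw [add_zero, sub_zero] at e6
  rw [e1, e2, e3, e4, show Theta4 0 τ * Theta1 (x + y + z) τ * (Theta1 z τ * Theta4 (x - y) τ) =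
    (Theta1 (x + y + z) τ * Theta1 z τ) * (Theta4 (x - y) τ * Theta4 0 τ) by ring, e5, e6]
  ring

lemma riemann_relation_one_mixed (x y z : ℂ) :
    Theta4 x τ * Theta1 y τ * (Theta1 (y + z) τ * Theta4 (z + x) τ) -
      Theta1 x τ * Theta4 y τ * (Theta4 (y + z) τ * Theta1 (z + x) τ) =
    -(Theta4 0 τ * Theta1 (x + y + z) τ * (Theta4 z τ * Theta1 (x - y) τ)) := by
  have e1 := Theta1_mul_Theta1 hτ (y + z) y
  have e2 := Theta4_mul_Theta4 hτ (z + x) x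
  have e3 := Theta4_mul_Theta4 hτ (y + z) y
  have e4 := Theta1_mul_Theta1 hτ (z + x) x
  have e5 := Theta1_mul_Theta1 hτ (x + y + z) (x - y)
  have e6 := Theta4_mul_Theta4 hτ z 0
  rw [show y + z + y = y + y + z by ring, show y + z - y = z by ring] at e1 e3
  rw [show z + x + x = x + x + z by ring, show z + x - x = z by ring] at e2 e4
  rw [show x + y + z + (x - y) = x + x + z by ring,
    show x + y + z - (x - y) = y + y + z by ring] at e5
  rw [add_zero, sub_zero] at e6
  rw [show Theta4 x τ * Theta1 y τ * (Theta1 (y + z) τ * Theta4 (z + x) τ) =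
    Theta1 (y + z) τ * Theta1 y τ * (Theta4 (z + x) τ * Theta4 x τ) by ring,
    show Theta1 x τ * Theta4 y τ * (Theta4 (y + z) τ * Theta1 (z + x) τ) =
    Theta4 (y + z) τ * Theta4 y τ * (Theta1 (z + x) τ * Theta1 x τ) by ring,
    show Theta4 0 τ * Theta1 (x + y + z) τ * (Theta4 z τ * Theta1 (x - y) τ) =
    Theta1 (x + y + z) τ * Theta1 (x - y) τ * (Theta4 z τ * Theta4 0 τ) by ring,
    e1, e2, e3, e4, e5, e6]
  ring

lemma riemann_relation_four_same (x y z : ℂ) :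
    Theta4 x τ * Theta4 y τ * (Theta4 (y + z) τ * Theta4 (z + x) τ) -
      Theta1 x τ * Theta1 y τ * (Theta1 (y + z) τ * Theta1 (z + x) τ) =
    Theta4 0 τ * Theta4 (x + y + z) τ * (Theta4 z τ * Theta4 (x - y) τ) := by
  have e1 := Theta4_mul_Theta4 hτ x y
  have e2 := Theta1_mul_Theta1 hτ (y + z) (z + x)
  have e3 := Theta1_mul_Theta1 hτ x y
  have e4 := Theta4_mul_Theta4 hτ (y + z) (z + x)
  have e5 := Theta4_mul_Theta4 hτ (x + y + z) z
  have e6 := Theta4_mul_Theta4 hτ (x - y) 0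
  rw [show y + z + (z + x) = x + y + z + z by ring, show y + z - (z + x) = -(x - y) by ring,
    Theta2_neg, Theta3_neg] at e2 e4
  rw [add_sub_cancel_right] at e5
  rw [add_zero, sub_zero] at e6
  rw [e1, e2, e3, e4, show Theta4 0 τ * Theta4 (x + y + z) τ * (Theta4 z τ * Theta4 (x - y) τ) =
    (Theta4 (x + y + z) τ * Theta4 z τ) * (Theta4 (x - y) τ * Theta4 0 τ) by ring, e5, e6]
  ring

lemma riemann_relation_four_mixed (x y z : ℂ) :
    Theta1 x τ * Theta4 y τ * (Theta1 (y + z) τ * Theta4 (z + x) τ) -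
      Theta4 x τ * Theta1 y τ * (Theta4 (y + z) τ * Theta1 (z + x) τ) =
    Theta4 0 τ * Theta4 (x + y + z) τ * (Theta1 z τ * Theta1 (x - y) τ) := by
  have e1 := Theta1_mul_Theta1 hτ (y + z) x
  have e2 := Theta4_mul_Theta4 hτ (z + x) y
  have e3 := Theta4_mul_Theta4 hτ (y + z) x
  have e4 := Theta1_mul_Theta1 hτ (z + x) y
  have e5 := Theta1_mul_Theta1 hτ z (x - y)
  have e6 := Theta4_mul_Theta4 hτ (x + y + z) 0
  rw [show y + z + x = x + y + z by ring, show y + z - x = z - (x - y) by ring] at e1 e3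
  rw [show z + x + y = x + y + z by ring, show z + x - y = z + (x - y) by ring] at e2 e4
  rw [add_zero, sub_zero] at e6
  rw [show Theta1 x τ * Theta4 y τ * (Theta1 (y + z) τ * Theta4 (z + x) τ) =
    Theta1 (y + z) τ * Theta1 x τ * (Theta4 (z + x) τ * Theta4 y τ) by ring,
    show Theta4 x τ * Theta1 y τ * (Theta4 (y + z) τ * Theta1 (z + x) τ) =
    Theta4 (y + z) τ * Theta4 x τ * (Theta1 (z + x) τ * Theta1 y τ) by ring,
    show Theta4 0 τ * Theta4 (x + y + z) τ * (Theta1 z τ * Theta1 (x - y) τ) =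
    Theta1 z τ * Theta1 (x - y) τ * (Theta4 (x + y + z) τ * Theta4 0 τ) by ring,
    e1, e2, e3, e4, e5, e6]
  ring

end Products

/-! ### The residue of a supertrace -/

/-- The exponent of the monomial `x₁ⁱ x₂ʲ`. -/
def expo (i j : ℕ) : Fin 3 →₀ ℕ := Finsupp.single 0 i + Finsupp.single 1 j

/-- The monomial `x₁ⁱ x₂ʲ`. -/
def mono (i j : ℕ) : Poly := monomial (expo i j) 1

lemma mono_eq (i j : ℕ) : mono i j = X 0 ^ i * X 1 ^ j := by
  simp [mono, expo, X_pow_eq_monomial, monomial_mul]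

lemma expo_add (i j k l : ℕ) : expo i j + expo k l = expo (i + k) (j + l) := by
  simp only [expo, Finsupp.single_add]
  abel

lemma mono_mul_mono (i j k l : ℕ) : mono i j * mono k l = mono (i + k) (j + l) := by
  rw [mono, mono, mono, monomial_mul, expo_add, one_mul]

lemma expo_inj (i j k l : ℕ) : expo i j = expo k l ↔ i = k ∧ j = l := by
  constructor
  · intro h
    have h0 := DFunLike.congr_fun h 0
    have h1 := DFunLike.congr_fun h 1
    simpa [expo] using And.intro h0 h1
  · rintro ⟨rfl, rfl⟩
    rfl

lemma coeff_mono_mul_C (i j k l : ℕ) (c : ℂ) :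
    coeff (expo i j) (mono k l * C c) = if k = i ∧ l = j then c else 0 := by
  rw [mono, mul_comm, C_mul_monomial, mul_one, coeff_monomial]
  simp only [expo_inj]

/-- The residue of `h` at the origin with respect to the partial derivatives of the superpotential.
The socle of the Jacobian ring is in degree `4`, and the residue reads off the coefficients of
`x₁⁴`, `x₁²x₂²` and `x₂⁴`. -/
lemma isGrothendieckResidue_superpotential {a : ℂ} (ha : a ^ 2 - 4 ≠ 0) (h : Poly) :
    IsGrothendieckResidue (fun i => pderiv i (superpotential a)) h
      ((a * (coeff (expo 4 0) h + coeff (expo 0 4) h) + 2 * coeff (expo 2 2) h) /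
        (16 * (a ^ 2 - 4))) := by
  have ha' : 4 - a ^ 2 ≠ 0 := fun h0 => ha (by linear_combination -h0)
  -- Multiplying `x₁⁵` by `8 (4 - a²)` gives an explicit combination of the partial derivatives.
  refine ⟨Finsupp.single 0 4 + Finsupp.single 1 4,
    !![C (1 / 4) * X 0 ^ 2 + C (a / (2 * (4 - a ^ 2))) * X 1 ^ 2,
        C (a ^ 2 / (4 * (4 - a ^ 2))) * X 0 * X 1, 0;
      C (a ^ 2 / (4 * (4 - a ^ 2))) * X 0 * X 1,
        C (1 / 4) * X 1 ^ 2 + C (a / (2 * (4 - a ^ 2))) * X 0 ^ 2, 0;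
      0, 0, C (-1 / 2)], ?_, ?_⟩
  · intro i
    apply MvPolynomial.funext
    intro x
    fin_cases i <;> simp [superpotential, Fin.sum_univ_three, pderiv_X, Pi.single_apply] <;>
      field_simp <;> ring
  · have hdet : (!![C (1 / 4) * X 0 ^ 2 + C (a / (2 * (4 - a ^ 2))) * X 1 ^ 2,
        C (a ^ 2 / (4 * (4 - a ^ 2))) * X 0 * X 1, 0;
      C (a ^ 2 / (4 * (4 - a ^ 2))) * X 0 * X 1,
        C (1 / 4) * X 1 ^ 2 + C (a / (2 * (4 - a ^ 2))) * X 0 ^ 2, 0;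
      0, 0, C (-1 / 2)] : Matrix (Fin 3) (Fin 3) Poly).det =
        monomial (expo 4 0) (a / (16 * (a ^ 2 - 4))) +
        monomial (expo 0 4) (a / (16 * (a ^ 2 - 4))) +
        monomial (expo 2 2) (2 / (16 * (a ^ 2 - 4))) := by
      have hm : ∀ (i j : ℕ) (c : ℂ), monomial (expo i j) c = C c * (X 0 ^ i * X 1 ^ j) := by
        intro i j c
        rw [← mono_eq, mono, C_mul_monomial, mul_one]
      rw [hm, hm, hm]
      apply MvPolynomial.funext
      intro x
      simp [det_fin_three]
      have h2 : a ^ 2 - 4 = -(4 - a ^ 2) := by ring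
      rw [h2]
      field_simp
      ring
    rw [hdet, mul_add h, mul_add h, coeff_add, coeff_add]
    have e1 : (Finsupp.single 0 4 + Finsupp.single 1 4 : Fin 3 →₀ ℕ) = expo 0 4 + expo 4 0 := by
      rw [expo_add]; rfl
    have e2 : (Finsupp.single 0 4 + Finsupp.single 1 4 : Fin 3 →₀ ℕ) = expo 4 0 + expo 0 4 := by
      rw [expo_add]; rfl
    have e3 : (Finsupp.single 0 4 + Finsupp.single 1 4 : Fin 3 →₀ ℕ) = expo 2 2 + expo 2 2 := by
      rw [expo_add]; rfl
    nth_rewrite 1 [e1]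
    rw [coeff_mul_monomial]
    nth_rewrite 1 [e2]
    rw [coeff_mul_monomial, e3, coeff_mul_monomial]
    ring

/-- `4 × 4` matrices of constants. -/
abbrev ScalarMatrix : Type := Matrix (Fin 2 ⊕ Fin 2) (Fin 2 ⊕ Fin 2) ℂ

/-- The supertrace of a matrix of constants. -/
def scalarSuperTrace (M : ScalarMatrix) : ℂ := M.toBlocks₁₁.trace - M.toBlocks₂₂.trace

/-- Matrices of constants as matrices of polynomials. -/
def constMatrix : ScalarMatrix →+* SuperMatrix := (C : ℂ →+* Poly).mapMatrix

lemma superTrace_add (M N : SuperMatrix) : superTrace (M + N) = superTrace M + superTrace N := by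
  simp only [superTrace, trace, diag_apply, toBlocks₁₁, toBlocks₂₂, of_apply, Matrix.add_apply,
    Finset.sum_add_distrib]
  ring

lemma superTrace_smul (f : Poly) (M : SuperMatrix) : superTrace (f • M) = f * superTrace M := by
  simp only [superTrace, trace, diag_apply, toBlocks₁₁, toBlocks₂₂, of_apply, Matrix.smul_apply,
    smul_eq_mul, Finset.mul_sum, mul_sub]

lemma superTrace_constMatrix (M : ScalarMatrix) :
    superTrace (constMatrix M) = C (scalarSuperTrace M) := by
  simp [superTrace, scalarSuperTrace, trace, toBlocks₁₁, toBlocks₂₂, constMatrix]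

lemma scalarSuperTrace_add (M N : ScalarMatrix) :
    scalarSuperTrace (M + N) = scalarSuperTrace M + scalarSuperTrace N := by
  simp only [scalarSuperTrace, trace, diag_apply, toBlocks₁₁, toBlocks₂₂, of_apply,
    Matrix.add_apply, Finset.sum_add_distrib]
  ring

lemma scalarSuperTrace_zero : scalarSuperTrace 0 = 0 := by
  simp [scalarSuperTrace, toBlocks₁₁, toBlocks₂₂, trace]

/-- A matrix of quadratic forms in `x₁, x₂`. -/
def quadPencil (U V W : ScalarMatrix) : SuperMatrix :=
  mono 2 0 • constMatrix U + mono 1 1 • constMatrix V + mono 0 2 • constMatrix W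

/-- A matrix of affine linear forms in `x₁, x₂`. -/
def linPencil (K A B : ScalarMatrix) : SuperMatrix :=
  mono 0 0 • constMatrix K + mono 1 0 • constMatrix A + mono 0 1 • constMatrix B

/-- The first state, which is between two long branes, has no constant part, so exactly one of
the other two states contributes its constant part to a quartic monomial. -/
lemma coeff_four_zero_superTrace (U V W A₁ B₁ K₂ A₂ B₂ K₃ A₃ B₃ : ScalarMatrix) :
    coeff (expo 4 0) (superTrace (quadPencil U V W * linPencil 0 A₁ B₁ * linPencil K₂ A₂ B₂ *
      linPencil K₃ A₃ B₃)) = scalarSuperTrace (U * A₁ * (K₂ * A₃ + A₂ * K₃)) := by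
  simp only [quadPencil, linPencil, mul_add, add_mul, smul_mul_assoc, mul_smul_comm,
    ← map_mul, superTrace_add, superTrace_smul, superTrace_constMatrix, coeff_add, ← mul_assoc,
    mono_mul_mono, coeff_mono_mul_C]
  norm_num [scalarSuperTrace_add, scalarSuperTrace_zero, ← mul_assoc]
  ring

lemma coeff_zero_four_superTrace (U V W A₁ B₁ K₂ A₂ B₂ K₃ A₃ B₃ : ScalarMatrix) :
    coeff (expo 0 4) (superTrace (quadPencil U V W * linPencil 0 A₁ B₁ * linPencil K₂ A₂ B₂ *
      linPencil K₃ A₃ B₃)) = scalarSuperTrace (W * B₁ * (K₂ * B₃ + B₂ * K₃)) := by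
  simp only [quadPencil, linPencil, mul_add, add_mul, smul_mul_assoc, mul_smul_comm,
    ← map_mul, superTrace_add, superTrace_smul, superTrace_constMatrix, coeff_add, ← mul_assoc,
    mono_mul_mono, coeff_mono_mul_C]
  norm_num [scalarSuperTrace_add, scalarSuperTrace_zero, ← mul_assoc]
  ring

lemma coeff_two_two_superTrace (U V W A₁ B₁ K₂ A₂ B₂ K₃ A₃ B₃ : ScalarMatrix) :
    coeff (expo 2 2) (superTrace (quadPencil U V W * linPencil 0 A₁ B₁ * linPencil K₂ A₂ B₂ *
      linPencil K₃ A₃ B₃)) = scalarSuperTrace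
        (U * B₁ * (K₂ * B₃ + B₂ * K₃) + V * A₁ * (K₂ * B₃ + B₂ * K₃) +
          V * B₁ * (K₂ * A₃ + A₂ * K₃) + W * A₁ * (K₂ * A₃ + A₂ * K₃)) := by
  simp only [quadPencil, linPencil, mul_add, add_mul, smul_mul_assoc, mul_smul_comm,
    ← map_mul, superTrace_add, superTrace_smul, superTrace_constMatrix, coeff_add, ← mul_assoc,
    mono_mul_mono, coeff_mono_mul_C]
  norm_num [scalarSuperTrace_add, scalarSuperTrace_zero, ← mul_assoc]
  ring

/-! ### Factorization of the matrices -/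

/-- The coefficients of `x₁²`, `x₁x₂`, `x₂²` in `(∂Q)^{∧3}` of the long brane, up to a common
factor. -/
def wedgePencil (p : Fin 3 → ℂ) : SuperMatrix :=
  quadPencil
    (fromBlocks 0 !![p 2 ^ 2 * p 0 ^ 2, 0; 0, -(p 2 ^ 2 * p 1 ^ 2)]
      !![p 2 ^ 2 * p 1 ^ 2, 0; 0, -(p 2 ^ 2 * p 0 ^ 2)] 0)
    (fromBlocks 0 !![0, p 1 ^ 4 - p 0 ^ 4; p 2 ^ 2 * (p 0 ^ 4 - p 1 ^ 4), 0]
      !![0, p 1 ^ 4 - p 0 ^ 4; p 2 ^ 2 * (p 0 ^ 4 - p 1 ^ 4), 0] 0)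
    (fromBlocks 0 !![p 2 ^ 2 * p 1 ^ 2, 0; 0, -(p 2 ^ 2 * p 0 ^ 2)]
      !![p 2 ^ 2 * p 0 ^ 2, 0; 0, -(p 2 ^ 2 * p 1 ^ 2)] 0)

lemma univ_perm_fin_three : (Finset.univ : Finset (Equiv.Perm (Fin 3))) =
    {1, Equiv.swap 0 1, Equiv.swap 0 2, Equiv.swap 1 2, Equiv.swap 0 1 * Equiv.swap 1 2,
      Equiv.swap 1 2 * Equiv.swap 0 1} := by
  decide

lemma sum_perm_fin_three {M : Type*} [AddCommGroup M] (f : Fin 3 → Fin 3 → Fin 3 → M) :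
    ∑ σ : Equiv.Perm (Fin 3), (Equiv.Perm.sign σ : ℤ) • f (σ 0) (σ 1) (σ 2) =
      f 0 1 2 - f 1 0 2 - f 2 1 0 - f 0 2 1 + f 1 2 0 + f 2 0 1 := by
  rw [univ_perm_fin_three, Finset.sum_insert (by decide), Finset.sum_insert (by decide),
    Finset.sum_insert (by decide), Finset.sum_insert (by decide), Finset.sum_insert (by decide),
    Finset.sum_singleton]
  have h : ∀ σ : Equiv.Perm (Fin 3), ∀ a b c : Fin 3, ∀ e : ℤ,
      (σ 0 = a ∧ σ 1 = b ∧ σ 2 = c ∧ (Equiv.Perm.sign σ : ℤ) = e) →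
      (Equiv.Perm.sign σ : ℤ) • f (σ 0) (σ 1) (σ 2) = e • f a b c := by
    rintro σ a b c e ⟨rfl, rfl, rfl, rfl⟩
    rfl
  rw [h 1 0 1 2 1 (by decide), h (Equiv.swap 0 1) 1 0 2 (-1) (by decide),
    h (Equiv.swap 0 2) 2 1 0 (-1) (by decide), h (Equiv.swap 1 2) 0 2 1 (-1) (by decide),
    h (Equiv.swap 0 1 * Equiv.swap 1 2) 1 2 0 1 (by decide),
    h (Equiv.swap 1 2 * Equiv.swap 0 1) 2 0 1 1 (by decide)]
  simp only [one_smul, neg_smul]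
  abel

lemma map_oddMatrix (E J : Block) (f : Poly → Poly) (hf : f 0 = 0) :
    (oddMatrix E J).map f = oddMatrix (E.map f) (J.map f) := by
  rw [oddMatrix, oddMatrix, fromBlocks_map, Matrix.map_zero f hf]

lemma oddMatrix_mul_mul (A B D F G H : Block) :
    oddMatrix A B * oddMatrix D F * oddMatrix G H = oddMatrix (A * F * G) (B * D * H) := by
  simp [oddMatrix, fromBlocks_multiply]

lemma wedgeDerivative_long {p : Fin 3 → ℂ} (h0 : p 0 ≠ 0) (h1 : p 1 ≠ 0) (h2 : p 2 ≠ 0) :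
    wedgeDerivative (Brane.long.Q p) =
      (2 / (p 0 ^ 2 * p 1 ^ 2 * p 2)) • wedgePencil p := by
  have hE : ∀ i, (Brane.long.Q p).map (pderiv i) =
      oddMatrix ((longE p).map (pderiv i)) ((longJ p).map (pderiv i)) := fun i =>
    map_oddMatrix _ _ _ (map_zero _)
  rw [wedgeDerivative, sum_perm_fin_three
    (fun i j k => (Brane.long.Q p).map (pderiv i) * (Brane.long.Q p).map (pderiv j) *
      (Brane.long.Q p).map (pderiv k))]
  simp only [hE, oddMatrix_mul_mul]
  ext1 i j
  apply MvPolynomial.funext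
  intro x
  rcases i with i | i <;> rcases j with j | j <;> fin_cases i <;> fin_cases j <;>
    simp [oddMatrix, longE, longJ, wedgePencil, quadPencil, constMatrix, mono_eq, mul_apply,
      pderiv_X, smul_eval]
  all_goals
    field_simp
    ring

namespace OpenString

/-- The coefficients of the state matrices are, up to monomials in the parameters, the four
polynomials `p₃q₁q₂ ± q₃p₁p₂`, `p₂²q₂² - p₁²q₁²`, `p₁²q₂² - p₂²q₁²`. Only two of them occur in each
state; `oddFactor` is the one that becomes a multiple of `θ₁(x ± y)`. -/
def oddFactor : OpenString → (Fin 3 → ℂ) → (Fin 3 → ℂ) → ℂ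
  | psiLL, p, q | psiBarLL, p, q => p 2 * q 0 * q 1 + q 2 * p 0 * p 1
  | phiLL, p, q | phiBarLL, p, q | phiLS, p, q | phiSL, p, q =>
      p 0 ^ 2 * q 1 ^ 2 - p 1 ^ 2 * q 0 ^ 2
  | psiLS, p, q | psiSL, p, q => q 2 * p 0 * p 1 - p 2 * q 0 * q 1

/-- The companion of `oddFactor` that becomes a multiple of `θ₄(x ± y)`. -/
def evenFactor : OpenString → (Fin 3 → ℂ) → (Fin 3 → ℂ) → ℂ
  | phiLL, p, q | phiBarLL, p, q => p 2 * q 0 * q 1 + q 2 * p 0 * p 1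
  | psiLL, p, q | psiBarLL, p, q | psiLS, p, q | psiSL, p, q =>
      p 1 ^ 2 * q 1 ^ 2 - p 0 ^ 2 * q 0 ^ 2
  | phiLS, p, q | phiSL, p, q => q 2 * p 0 * p 1 - p 2 * q 0 * q 1

/-- The common denominator of the entries of a state matrix. -/
def scale : OpenString → (Fin 3 → ℂ) → (Fin 3 → ℂ) → ℂ
  | psiLL, p, q => 1 / (p 0 ^ 2 * p 1 * p 2 * q 0 ^ 2 * q 1 * q 2)
  | psiBarLL, p, q => 1 / (p 0 * p 1 * p 2 * q 0 * q 1 * q 2)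
  | phiLL, p, q => p 0 / (p 1 * p 2 * q 0 ^ 2 * q 1 * q 2)
  | phiBarLL, p, q => 1 / (p 0 * p 1 * q 0 * q 1 * q 2 ^ 2)
  | psiLS, p, q => 1 / (p 0 * p 1 * p 2 ^ 2 * q 0 ^ 2 * q 1 ^ 2)
  | phiLS, p, q => 1 / (p 0 * p 1 ^ 3 * p 2 * q 0 ^ 3 * q 1 * q 2)
  | psiSL, p, q => 1 / (p 1 ^ 3 * p 2 * q 0 ^ 2 * q 1 ^ 2 * q 2)
  | phiSL, p, q => 1 / (p 0 ^ 3 * p 2 * q 0 ^ 2 * q 1 ^ 2 * q 2)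

/-- The constant part of a rescaled state matrix, in which the two factors are replaced by `s`
and `t`. -/
def constPart : OpenString → (p q : Fin 3 → ℂ) → (s t : ℂ) → ScalarMatrix
  | psiLS, p, q, s, t => fromBlocks 0
      !![-(p 0 * p 1 * q 0 * q 1 * s), 0; p 0 * p 1 * p 2 * q 0 * q 1 * t, 0]
      !![0, -(p 0 * p 1 * q 0 * q 1 * q 2 * t); 0, p 0 * p 1 * p 2 * q 0 * q 1 * q 2 * s] 0
  | phiLS, p, q, s, t => fromBlocks
      !![0, p 0 * p 1 * q 0 * q 1 * q 2 * s; 0, p 0 * p 1 * p 2 * q 0 * q 1 * q 2 * t] 0 0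
      !![-(p 0 * p 1 * q 0 * q 1 * t), 0; -(p 0 * p 1 * p 2 * q 0 * q 1 * s), 0]
  | psiSL, p, q, s, t => fromBlocks 0
      !![-(p 0 * p 1 * p 2 * q 0 * q 1 * q 2 * s), p 0 * p 1 * p 2 * q 0 * q 1 * t; 0, 0]
      !![0, 0; p 0 * p 1 * q 0 * q 1 * q 2 * t, -(p 0 * p 1 * q 0 * q 1 * s)] 0
  | phiSL, p, q, s, t => fromBlocks
      !![-(p 0 * p 1 * p 2 * q 0 * q 1 * q 2 * t), p 0 * p 1 * p 2 * q 0 * q 1 * s; 0, 0] 0 0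
      !![0, 0; p 0 * p 1 * q 0 * q 1 * q 2 * s, -(p 0 * p 1 * q 0 * q 1 * t)]
  | _, _, _, _, _ => 0

/-- The coefficient of `x₁` in a rescaled state matrix. -/
def xPart : OpenString → (p q : Fin 3 → ℂ) → (s t : ℂ) → ScalarMatrix
  | psiLL, p, q, s, _ => fromBlocks 0
      !![p 0 * q 0 * q 2 * s, 0; 0, -(p 1 * p 2 * q 1 * s)]
      !![-(p 1 * q 1 * q 2 * s), 0; 0, p 0 * p 2 * q 0 * s] 0
  | psiBarLL, p, q, _, t => fromBlocks 0
      !![0, p 0 * q 1 * t; -(p 1 * p 2 * q 0 * q 2 * t), 0]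
      !![0, -(p 1 * q 0 * t); p 0 * p 2 * q 1 * q 2 * t, 0] 0
  | phiLL, p, q, s, _ => fromBlocks
      !![0, p 0 * q 0 * s; p 1 * p 2 * q 1 * q 2 * s, 0] 0 0
      !![0, p 1 * q 1 * s; p 0 * p 2 * q 0 * q 2 * s, 0]
  | phiBarLL, p, q, _, t => fromBlocks
      !![p 0 * q 1 * q 2 * t, 0; 0, p 1 * p 2 * q 0 * t] 0 0
      !![p 1 * q 0 * q 2 * t, 0; 0, p 0 * p 2 * q 1 * t]
  | psiLS, p, q, s, t => fromBlocks 0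
      !![0, -(p 0 ^ 2 * q 1 * q 2 * t); 0, p 1 ^ 2 * p 2 * q 1 * q 2 * s]
      !![p 1 ^ 2 * q 1 * s, 0; -(p 0 ^ 2 * p 2 * q 1 * t), 0] 0
  | phiLS, p, q, s, t => fromBlocks
      !![-(p 0 ^ 2 * q 1 * t), 0; -(p 1 ^ 2 * p 2 * q 1 * s), 0] 0 0
      !![0, -(p 1 ^ 2 * q 1 * q 2 * s); 0, -(p 0 ^ 2 * p 2 * q 1 * q 2 * t)]
  | psiSL, p, q, s, t => fromBlocks 0
      !![0, 0; p 1 * q 0 ^ 2 * q 2 * t, -(p 1 * q 1 ^ 2 * s)]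
      !![p 1 * p 2 * q 1 ^ 2 * q 2 * s, -(p 1 * p 2 * q 0 ^ 2 * t); 0, 0] 0
  | phiSL, p, q, s, t => fromBlocks
      !![0, 0; -(p 1 * q 1 ^ 2 * q 2 * s), p 1 * q 0 ^ 2 * t] 0 0
      !![-(p 1 * p 2 * q 0 ^ 2 * q 2 * t), p 1 * p 2 * q 1 ^ 2 * s; 0, 0]

/-- The coefficient of `x₂` in a rescaled state matrix. -/
def yPart : OpenString → (p q : Fin 3 → ℂ) → (s t : ℂ) → ScalarMatrix
  | psiLL, p, q, _, t => fromBlocks 0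
      !![0, p 1 * q 0 * t; -(p 0 * p 2 * q 1 * q 2 * t), 0]
      !![0, -(p 0 * q 1 * t); p 1 * p 2 * q 0 * q 2 * t, 0] 0
  | psiBarLL, p, q, s, _ => fromBlocks 0
      !![p 1 * q 1 * q 2 * s, 0; 0, -(p 0 * p 2 * q 0 * s)]
      !![-(p 0 * q 0 * q 2 * s), 0; 0, p 1 * p 2 * q 1 * s] 0
  | phiLL, p, q, _, t => fromBlocks
      !![p 1 * q 0 * q 2 * t, 0; 0, p 0 * p 2 * q 1 * t] 0 0
      !![p 0 * q 1 * q 2 * t, 0; 0, p 1 * p 2 * q 0 * t]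
  | phiBarLL, p, q, s, _ => fromBlocks
      !![0, p 1 * q 1 * s; p 0 * p 2 * q 0 * q 2 * s, 0] 0 0
      !![0, p 0 * q 0 * s; p 1 * p 2 * q 1 * q 2 * s, 0]
  | psiLS, p, q, s, t => fromBlocks 0
      !![0, p 1 ^ 2 * q 0 * q 2 * t; 0, -(p 0 ^ 2 * p 2 * q 0 * q 2 * s)]
      !![-(p 0 ^ 2 * q 0 * s), 0; p 1 ^ 2 * p 2 * q 0 * t, 0] 0
  | phiLS, p, q, s, t => fromBlocks
      !![p 1 ^ 2 * q 0 * t, 0; p 0 ^ 2 * p 2 * q 0 * s, 0] 0 0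
      !![0, p 0 ^ 2 * q 0 * q 2 * s; 0, p 1 ^ 2 * p 2 * q 0 * q 2 * t]
  | psiSL, p, q, s, t => fromBlocks 0
      !![0, 0; -(p 0 * q 1 ^ 2 * q 2 * t), p 0 * q 0 ^ 2 * s]
      !![-(p 0 * p 2 * q 0 ^ 2 * q 2 * s), p 0 * p 2 * q 1 ^ 2 * t; 0, 0] 0
  | phiSL, p, q, s, t => fromBlocks
      !![0, 0; p 0 * q 0 ^ 2 * q 2 * s, -(p 0 * q 1 ^ 2 * t)] 0 0
      !![p 0 * p 2 * q 1 ^ 2 * q 2 * t, -(p 0 * p 2 * q 0 ^ 2 * s); 0, 0]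

/-- The rescaled state matrix; it is polynomial in the parameters and linear in `(s, t)`. -/
def pencil (ψ : OpenString) (p q : Fin 3 → ℂ) (s t : ℂ) : SuperMatrix :=
  linPencil (ψ.constPart p q s t) (ψ.xPart p q s t) (ψ.yPart p q s t)

lemma pencil_smul (ψ : OpenString) (p q : Fin 3 → ℂ) (c s t : ℂ) :
    ψ.pencil p q (c * s) (c * t) = c • ψ.pencil p q s t := by
  have hc : ψ.constPart p q (c * s) (c * t) = c • ψ.constPart p q s t := by
    ext1 i j
    cases ψ <;> rcases i with i | i <;> rcases j with j | j <;> fin_cases i <;> fin_cases j <;>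
      simp [constPart, mul_left_comm c]
  have hx : ψ.xPart p q (c * s) (c * t) = c • ψ.xPart p q s t := by
    ext1 i j
    cases ψ <;> rcases i with i | i <;> rcases j with j | j <;> fin_cases i <;> fin_cases j <;>
      simp [xPart, mul_left_comm c]
  have hy : ψ.yPart p q (c * s) (c * t) = c • ψ.yPart p q s t := by
    ext1 i j
    cases ψ <;> rcases i with i | i <;> rcases j with j | j <;> fin_cases i <;> fin_cases j <;>
      simp [yPart, mul_left_comm c]
  have hι : ∀ M : ScalarMatrix, constMatrix (c • M) = c • constMatrix M := by
    intro M
    ext1 i j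
    simp [constMatrix, smul_eq_C_mul]
  rw [pencil, pencil, linPencil, linPencil, hc, hx, hy, hι, hι, hι, smul_add, smul_add,
    smul_comm, smul_comm (mono 1 0), smul_comm (mono 0 1)]

set_option maxHeartbeats 2000000 in
-- eight states with sixteen entries each
/-- The state matrices in terms of their two factors. -/
lemma mat_eq_pencil (ψ : OpenString) {p q : Fin 3 → ℂ} (hp : ∀ i, p i ≠ 0) (hq : ∀ i, q i ≠ 0) :
    ψ.mat p q = ψ.scale p q • ψ.pencil p q (ψ.oddFactor p q) (ψ.evenFactor p q) := by
  have p0 := hp 0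
  have p1 := hp 1
  have p2 := hp 2
  have q0 := hq 0
  have q1 := hq 1
  have q2 := hq 2
  ext1 i j
  apply MvPolynomial.funext
  intro x
  cases ψ
  all_goals
    rcases i with i | i <;> rcases j with j | j <;> fin_cases i <;> fin_cases j <;>
    simp [mat, oddMatrix, evenMatrix, psiLL₀, psiBarLL₀, phiLL₀, phiBarLL₀, psiSL₀, phiSL₀,
      psiLS₀, phiLS₀, pencil, linPencil, constPart, xPart, yPart, oddFactor, evenFactor, scale,
      constMatrix, mono_eq, smul_eval]
  all_goals
    field_simp
    try ring1

end OpenString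

/-! ### Matrix factorizations and the physical state condition -/

lemma Brane.Q_sq (B : Brane) {a : ℂ} {p : Fin 3 → ℂ} (hp : ∀ i, p i ≠ 0)
    (h : p 0 ^ 4 + p 1 ^ 4 - p 2 ^ 2 - a * p 0 ^ 2 * p 1 ^ 2 = 0) :
    B.Q p ^ 2 = superpotential a • (1 : SuperMatrix) := by
  have p0 := hp 0
  have p1 := hp 1
  have p2 := hp 2
  -- With `a` eliminated the entries are identities of rational functions.
  have ha : a = (p 0 ^ 4 + p 1 ^ 4 - p 2 ^ 2) / (p 0 ^ 2 * p 1 ^ 2) := by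
    field_simp
    linear_combination -h
  rw [pow_two]
  ext1 i j
  apply MvPolynomial.funext
  intro x
  cases B
  all_goals
    rcases i with i | i <;> rcases j with j | j <;> fin_cases i <;> fin_cases j <;>
    simp [Brane.Q, oddMatrix, longE, longJ, shortE, shortJ, superpotential, mul_apply, ha]
  all_goals
    field_simp
    try ring1

namespace OpenString

/-- The cofactor of the difference of the bulk parameters of the two branes in the physical state
condition, for parameters that need not lie on the same curve. -/
def defect : OpenString → (p q : Fin 3 → ℂ) → SuperMatrix
  | psiLL, p, q => evenMatrix
      !![0, C (-1 / (p 0 ^ 2 * p 1 ^ 2 * p 2 * q 0 ^ 2 * q 1 ^ 2 * q 2)) * mono 2 1;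
        C (-1 / (p 0 ^ 3 * p 1 * q 0 ^ 3 * q 1)) * mono 2 1, 0]
      !![0, C (-1 / (p 0 ^ 3 * p 1 * p 2 * q 0 ^ 3 * q 1 * q 2)) * mono 2 1;
        C (-1 / (p 0 ^ 2 * p 1 ^ 2 * q 0 ^ 2 * q 1 ^ 2)) * mono 2 1, 0]
  | psiBarLL, p, q => evenMatrix
      !![0, C (-1 / (p 0 ^ 2 * p 1 * p 2 * q 0 ^ 2 * q 1 * q 2)) * mono 1 2;
        C (-1 / (p 0 * p 1 ^ 2 * q 0 * q 1 ^ 2)) * mono 1 2, 0]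
      !![0, C (-1 / (p 0 * p 1 ^ 2 * p 2 * q 0 * q 1 ^ 2 * q 2)) * mono 1 2;
        C (-1 / (p 0 ^ 2 * p 1 * q 0 ^ 2 * q 1)) * mono 1 2, 0]
  | phiLL, p, q => oddMatrix
      !![0, C (-1 / (p 1 * p 2 * q 0 ^ 2 * q 1 ^ 2 * q 2)) * mono 1 2;
        C (p 0 / (p 1 ^ 2 * q 0 ^ 3 * q 1)) * mono 1 2, 0]
      !![0, C (p 0 / (p 1 ^ 2 * p 2 * q 0 ^ 3 * q 1 * q 2)) * mono 1 2;
        C (-1 / (p 1 * q 0 ^ 2 * q 1 ^ 2)) * mono 1 2, 0]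
  | phiBarLL, p, q => oddMatrix
      !![0, C (-1 / (p 0 * p 1 ^ 2 * q 0 ^ 2 * q 1 * q 2 ^ 2)) * mono 2 1;
        C (p 2 / (p 0 ^ 2 * p 1 * q 0 * q 1 ^ 2 * q 2)) * mono 2 1, 0]
      !![0, C (1 / (p 0 ^ 2 * p 1 * q 0 * q 1 ^ 2 * q 2 ^ 2)) * mono 2 1;
        C (-p 2 / (p 0 * p 1 ^ 2 * q 0 ^ 2 * q 1 * q 2)) * mono 2 1, 0]
  | psiSL, p, q => evenMatrix
      !![0, C (1 / (p 1 ^ 3 * q 0 ^ 2 * q 1 ^ 2 * q 2)) * mono 1 1;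
        C (1 / (p 1 ^ 4 * p 2 * q 0 * q 1 ^ 3)) * mono 1 2 -
          C (1 / (p 0 * p 1 ^ 3 * p 2 * q 0 ^ 3 * q 1)) * mono 2 1, 0]
      !![0, C (1 / (p 0 * p 1 ^ 3 * q 0 ^ 3 * q 1 * q 2)) * mono 2 1 -
          C (1 / (p 1 ^ 4 * q 0 * q 1 ^ 3 * q 2)) * mono 1 2;
        C (1 / (p 1 ^ 3 * p 2 * q 0 ^ 2 * q 1 ^ 2)) * mono 1 1, 0]
  | phiSL, p, q => oddMatrix
      !![0, C (1 / (p 0 ^ 3 * q 0 ^ 2 * q 1 ^ 2 * q 2)) * mono 1 1;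
        C (1 / (p 0 ^ 4 * p 2 * q 0 * q 1 ^ 3)) * mono 2 1 -
          C (1 / (p 0 ^ 3 * p 1 * p 2 * q 0 ^ 3 * q 1)) * mono 1 2, 0]
      !![0, C (1 / (p 0 ^ 3 * p 1 * q 0 ^ 3 * q 1 * q 2)) * mono 1 2 -
          C (1 / (p 0 ^ 4 * q 0 * q 1 ^ 3 * q 2)) * mono 2 1;
        C (1 / (p 0 ^ 3 * p 2 * q 0 ^ 2 * q 1 ^ 2)) * mono 1 1, 0]
  | psiLS, p, q => evenMatrix
      !![0, C (q 2 / (p 0 * p 1 * p 2 ^ 2 * q 0 ^ 2 * q 1 ^ 2)) * mono 1 1;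
        C (1 / (p 1 ^ 2 * p 2 * q 0 ^ 2 * q 1 ^ 3)) * mono 1 2 -
          C (1 / (p 0 ^ 2 * p 2 * q 0 ^ 3 * q 1 ^ 2)) * mono 2 1, 0]
      !![0, C (q 2 / (p 1 ^ 2 * p 2 ^ 2 * q 0 ^ 2 * q 1 ^ 3)) * mono 1 2 -
          C (q 2 / (p 0 ^ 2 * p 2 ^ 2 * q 0 ^ 3 * q 1 ^ 2)) * mono 2 1;
        C (-1 / (p 0 * p 1 * p 2 * q 0 ^ 2 * q 1 ^ 2)) * mono 1 1, 0]
  | phiLS, p, q => oddMatrix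
      !![0, C (1 / (p 0 ^ 2 * p 1 ^ 2 * p 2 * q 0 ^ 3 * q 1 ^ 2)) * mono 1 2 -
          C (1 / (p 1 ^ 4 * p 2 * q 0 ^ 4 * q 1)) * mono 2 1;
        C (1 / (p 0 * p 1 ^ 3 * q 0 ^ 3 * q 1 * q 2)) * mono 1 1, 0]
      !![0, C (-1 / (p 0 * p 1 ^ 3 * p 2 * q 0 ^ 3 * q 1)) * mono 1 1;
        C (1 / (p 0 ^ 2 * p 1 ^ 2 * q 0 ^ 3 * q 1 ^ 2 * q 2)) * mono 1 2 -
          C (1 / (p 1 ^ 4 * q 0 ^ 4 * q 1 * q 2)) * mono 2 1, 0]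

lemma odd_commutator (E J M N E' J' : Block) :
    oddMatrix E J * oddMatrix M N - (-1) ^ 1 • (oddMatrix M N * oddMatrix E' J') =
      evenMatrix (E * N + M * J') (J * M + N * E') := by
  simp [oddMatrix, evenMatrix, fromBlocks_multiply, fromBlocks_add]

lemma even_commutator (E J M N E' J' : Block) :
    oddMatrix E J * evenMatrix M N - (-1) ^ 0 • (evenMatrix M N * oddMatrix E' J') =
      oddMatrix (E * N - M * E') (J * M - N * J') := by
  simp [oddMatrix, evenMatrix, fromBlocks_multiply, sub_eq_add_neg, fromBlocks_neg, fromBlocks_add]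

lemma smul_evenMatrix (c : ℂ) (M N : Block) :
    c • evenMatrix M N = evenMatrix (c • M) (c • N) := by
  simp [evenMatrix, fromBlocks_smul]

lemma smul_oddMatrix (c : ℂ) (M N : Block) :
    c • oddMatrix M N = oddMatrix (c • M) (c • N) := by
  simp [oddMatrix, fromBlocks_smul]

set_option maxHeartbeats 2000000 in
-- eight states with eight entries each
/-- The scalar on the right is `p₁²p₂²q₁²q₂²` times the difference of the bulk parameters for
which the two branes are matrix factorizations; it vanishes when they coincide. -/
lemma commutator_eq_defect (ψ : OpenString) {p q : Fin 3 → ℂ} (hp : ∀ i, p i ≠ 0)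
    (hq : ∀ i, q i ≠ 0) :
    ψ.source.Q p * ψ.mat p q - (-1) ^ ψ.degree • (ψ.mat p q * ψ.target.Q q) =
      (q 0 ^ 2 * q 1 ^ 2 * (p 2 ^ 2 - p 0 ^ 4 - p 1 ^ 4) -
        p 0 ^ 2 * p 1 ^ 2 * (q 2 ^ 2 - q 0 ^ 4 - q 1 ^ 4)) • ψ.defect p q := by
  have p0 := hp 0
  have p1 := hp 1
  have p2 := hp 2
  have q0 := hq 0
  have q1 := hq 1
  have q2 := hq 2
  cases ψ
  case psiLL =>
    refine (odd_commutator _ _ _ _ _ _).trans ?_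
    rw [defect, smul_evenMatrix]
    congr 1 <;> ext1 i j <;> refine MvPolynomial.funext fun x => ?_ <;> fin_cases i <;>
      fin_cases j <;> simp [psiLL₀, longE, longJ, mono_eq,
        smul_eval] <;>
      field_simp <;> ring1
  case psiBarLL =>
    refine (odd_commutator _ _ _ _ _ _).trans ?_
    rw [defect, smul_evenMatrix]
    congr 1 <;> ext1 i j <;> refine MvPolynomial.funext fun x => ?_ <;> fin_cases i <;>
      fin_cases j <;> simp [psiBarLL₀, longE, longJ, mono_eq,
        smul_eval] <;>
      field_simp <;> ring1
  case phiLL =>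
    refine (even_commutator _ _ _ _ _ _).trans ?_
    rw [defect, smul_oddMatrix]
    congr 1 <;> ext1 i j <;> refine MvPolynomial.funext fun x => ?_ <;> fin_cases i <;>
      fin_cases j <;> simp [phiLL₀, longE, longJ, mono_eq,
        smul_eval] <;>
      field_simp <;> ring1
  case phiBarLL =>
    refine (even_commutator _ _ _ _ _ _).trans ?_
    rw [defect, smul_oddMatrix]
    congr 1 <;> ext1 i j <;> refine MvPolynomial.funext fun x => ?_ <;> fin_cases i <;>
      fin_cases j <;> simp [phiBarLL₀, longE, longJ, mono_eq,
        smul_eval] <;>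
      field_simp <;> ring1
  case psiLS =>
    refine (odd_commutator _ _ _ _ _ _).trans ?_
    rw [defect, smul_evenMatrix]
    congr 1 <;> ext1 i j <;> refine MvPolynomial.funext fun x => ?_ <;> fin_cases i <;>
      fin_cases j <;> simp [psiLS₀, longE, longJ, shortE, shortJ, mono_eq,
        smul_eval] <;>
      field_simp <;> ring1
  case phiLS =>
    refine (even_commutator _ _ _ _ _ _).trans ?_
    rw [defect, smul_oddMatrix]
    congr 1 <;> ext1 i j <;> refine MvPolynomial.funext fun x => ?_ <;> fin_cases i <;>
      fin_cases j <;> simp [phiLS₀, longE, longJ, shortE, shortJ, mono_eq,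
        smul_eval] <;>
      field_simp <;> ring1
  case psiSL =>
    refine (odd_commutator _ _ _ _ _ _).trans ?_
    rw [defect, smul_evenMatrix]
    congr 1 <;> ext1 i j <;> refine MvPolynomial.funext fun x => ?_ <;> fin_cases i <;>
      fin_cases j <;> simp [psiSL₀, longE, longJ, shortE, shortJ, mono_eq,
        smul_eval] <;>
      field_simp <;> ring1
  case phiSL =>
    refine (even_commutator _ _ _ _ _ _).trans ?_
    rw [defect, smul_oddMatrix]
    congr 1 <;> ext1 i j <;> refine MvPolynomial.funext fun x => ?_ <;> fin_cases i <;>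
      fin_cases j <;> simp [phiSL₀, longE, longJ, shortE, shortJ, mono_eq,
        smul_eval] <;>
      field_simp <;> ring1

lemma isPhysical (ψ : OpenString) {a : ℂ} {p q : Fin 3 → ℂ} (hp : ∀ i, p i ≠ 0)
    (hq : ∀ i, q i ≠ 0) (hpa : p 0 ^ 4 + p 1 ^ 4 - p 2 ^ 2 - a * p 0 ^ 2 * p 1 ^ 2 = 0)
    (hqa : q 0 ^ 4 + q 1 ^ 4 - q 2 ^ 2 - a * q 0 ^ 2 * q 1 ^ 2 = 0) : ψ.IsPhysical p q := by
  rw [IsPhysical, commutator_eq_defect ψ hp hq]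
  convert zero_smul ℂ _
  linear_combination (-(q 0 ^ 2 * q 1 ^ 2)) * hpa + p 0 ^ 2 * p 1 ^ 2 * hqa

end OpenString

/-! ### The numerator of the residue -/

lemma scalarSuperTrace_fromBlocks (A B D F : Matrix (Fin 2) (Fin 2) ℂ) :
    scalarSuperTrace (fromBlocks A B D F) = A.trace - F.trace := by
  simp [scalarSuperTrace]

/-- The value of the residue formula for three rescaled state matrices, up to a constant: the
combination of coefficients of the supertrace that enters the residue. -/
def residueNumerator (a : ℂ) (p : Fin 3 → ℂ) (Ψ₁ Ψ₂ Ψ₃ : SuperMatrix) : ℂ :=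
  let h := superTrace (wedgePencil p * Ψ₁ * Ψ₂ * Ψ₃)
  a * (coeff (expo 4 0) h + coeff (expo 0 4) h) + 2 * coeff (expo 2 2) h

/-- The common form of the numerators of all eight correlators. Here `P₁, P₄` are the theta values
in the long-long state, `A₁` and `A₂` are bilinear in those of the other two states, and `ρ₁, ρ₂`
are `r₁, r₂` in one of the two orders. -/
def numeratorForm (a : ℂ) (p q r : Fin 3 → ℂ) (P₁ P₄ A₁ A₂ ρ₁ ρ₂ : ℂ) : ℂ :=
  4 * p 2 ^ 2 * q 2 * r 0 * r 1 * r 2 *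
    (ρ₁ * (P₁ * A₁ * (p 2 * (p 0 ^ 4 + p 1 ^ 4 + a * p 0 ^ 2 * p 1 ^ 2) * q 0 * q 1) +
        P₄ * A₁ * ((p 0 ^ 4 - p 1 ^ 4) * (p 0 ^ 2 * q 1 ^ 2 + p 1 ^ 2 * q 0 ^ 2))) +
      ρ₂ * (P₁ * A₂ * ((p 0 ^ 4 - p 1 ^ 4) * (p 0 ^ 2 * q 0 ^ 2 + p 1 ^ 2 * q 1 ^ 2)) +
        P₄ * A₂ * (p 2 * (p 0 ^ 4 + p 1 ^ 4 + a * p 0 ^ 2 * p 1 ^ 2) * q 0 * q 1)))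

section Numerators

variable (a : ℂ) (p q r : Fin 3 → ℂ) (P₁ P₄ Q₁ Q₄ R₁ R₄ : ℂ)

lemma residueNumerator_psiLL_psiLS_psiSL :
    residueNumerator a p (OpenString.psiLL.pencil p q P₁ P₄) (OpenString.psiLS.pencil q r Q₁ Q₄)
      (OpenString.psiSL.pencil r p R₁ R₄) =
    numeratorForm a p q r P₁ P₄ (p 1 * q 1 * (Q₁ * R₁) + p 0 * q 0 * (Q₄ * R₄))
      (p 1 * q 0 * (Q₁ * R₄) + p 0 * q 1 * (Q₄ * R₁)) (r 1) (r 0) := by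
  simp only [residueNumerator, wedgePencil, OpenString.pencil, OpenString.constPart,
    OpenString.xPart, OpenString.yPart, coeff_four_zero_superTrace, coeff_zero_four_superTrace,
    coeff_two_two_superTrace, fromBlocks_multiply, fromBlocks_add, mul_fin_two, zero_add,
    add_zero, scalarSuperTrace_fromBlocks, trace_fin_two_of, trace_add, mul_zero, zero_mul,
    numeratorForm, Matrix.mul_add]
  ring

lemma residueNumerator_psiLL_phiLS_phiSL :
    residueNumerator a p (OpenString.psiLL.pencil p q P₁ P₄) (OpenString.phiLS.pencil q r Q₁ Q₄)
      (OpenString.phiSL.pencil r p R₁ R₄) =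
    numeratorForm a p q r P₁ P₄ (p 1 * q 1 * (Q₁ * R₁) - p 0 * q 0 * (Q₄ * R₄))
      (p 1 * q 0 * (Q₁ * R₄) - p 0 * q 1 * (Q₄ * R₁)) (r 1) (r 0) := by
  simp only [residueNumerator, wedgePencil, OpenString.pencil, OpenString.constPart,
    OpenString.xPart, OpenString.yPart, coeff_four_zero_superTrace, coeff_zero_four_superTrace,
    coeff_two_two_superTrace, fromBlocks_multiply, fromBlocks_add, mul_fin_two, zero_add,
    add_zero, scalarSuperTrace_fromBlocks, trace_fin_two_of, trace_add, mul_zero, zero_mul,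
    numeratorForm, Matrix.mul_add]
  ring

lemma residueNumerator_phiLL_psiLS_phiSL :
    residueNumerator a p (OpenString.phiLL.pencil p q P₁ P₄) (OpenString.psiLS.pencil q r Q₁ Q₄)
      (OpenString.phiSL.pencil r p R₁ R₄) =
    numeratorForm a p q r (-P₁) P₄ (p 1 * q 1 * (Q₁ * R₁) - p 0 * q 0 * (Q₄ * R₄))
      (p 1 * q 0 * (Q₁ * R₄) - p 0 * q 1 * (Q₄ * R₁)) (r 1) (r 0) := by
  simp only [residueNumerator, wedgePencil, OpenString.pencil, OpenString.constPart,
    OpenString.xPart, OpenString.yPart, coeff_four_zero_superTrace, coeff_zero_four_superTrace,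
    coeff_two_two_superTrace, fromBlocks_multiply, fromBlocks_add, mul_fin_two, zero_add,
    add_zero, scalarSuperTrace_fromBlocks, trace_fin_two_of, trace_add, mul_zero, zero_mul,
    numeratorForm, Matrix.mul_add]
  ring

lemma residueNumerator_phiLL_phiLS_psiSL :
    residueNumerator a p (OpenString.phiLL.pencil p q P₁ P₄) (OpenString.phiLS.pencil q r Q₁ Q₄)
      (OpenString.psiSL.pencil r p R₁ R₄) =
    numeratorForm a p q r (-P₁) P₄ (p 1 * q 1 * (Q₁ * R₁) + p 0 * q 0 * (Q₄ * R₄))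
      (p 1 * q 0 * (Q₁ * R₄) + p 0 * q 1 * (Q₄ * R₁)) (r 1) (r 0) := by
  simp only [residueNumerator, wedgePencil, OpenString.pencil, OpenString.constPart,
    OpenString.xPart, OpenString.yPart, coeff_four_zero_superTrace, coeff_zero_four_superTrace,
    coeff_two_two_superTrace, fromBlocks_multiply, fromBlocks_add, mul_fin_two, zero_add,
    add_zero, scalarSuperTrace_fromBlocks, trace_fin_two_of, trace_add, mul_zero, zero_mul,
    numeratorForm, Matrix.mul_add]
  ring

lemma residueNumerator_psiBarLL_psiLS_psiSL :
    residueNumerator a p (OpenString.psiBarLL.pencil p q P₁ P₄) (OpenString.psiLS.pencil q r Q₁ Q₄)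
      (OpenString.psiSL.pencil r p R₁ R₄) =
    -numeratorForm a p q r P₁ P₄ (p 0 * q 0 * (Q₁ * R₁) + p 1 * q 1 * (Q₄ * R₄))
      (p 0 * q 1 * (Q₁ * R₄) + p 1 * q 0 * (Q₄ * R₁)) (r 0) (r 1) := by
  simp only [residueNumerator, wedgePencil, OpenString.pencil, OpenString.constPart,
    OpenString.xPart, OpenString.yPart, coeff_four_zero_superTrace, coeff_zero_four_superTrace,
    coeff_two_two_superTrace, fromBlocks_multiply, fromBlocks_add, mul_fin_two, zero_add,
    add_zero, scalarSuperTrace_fromBlocks, trace_fin_two_of, trace_add, mul_zero, zero_mul,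
    numeratorForm, Matrix.mul_add]
  ring

lemma residueNumerator_psiBarLL_phiLS_phiSL :
    residueNumerator a p (OpenString.psiBarLL.pencil p q P₁ P₄) (OpenString.phiLS.pencil q r Q₁ Q₄)
      (OpenString.phiSL.pencil r p R₁ R₄) =
    -numeratorForm a p q r P₁ P₄ (p 0 * q 0 * (Q₁ * R₁) - p 1 * q 1 * (Q₄ * R₄))
      (p 0 * q 1 * (Q₁ * R₄) - p 1 * q 0 * (Q₄ * R₁)) (r 0) (r 1) := by
  simp only [residueNumerator, wedgePencil, OpenString.pencil, OpenString.constPart,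
    OpenString.xPart, OpenString.yPart, coeff_four_zero_superTrace, coeff_zero_four_superTrace,
    coeff_two_two_superTrace, fromBlocks_multiply, fromBlocks_add, mul_fin_two, zero_add,
    add_zero, scalarSuperTrace_fromBlocks, trace_fin_two_of, trace_add, mul_zero, zero_mul,
    numeratorForm, Matrix.mul_add]
  ring

lemma residueNumerator_phiBarLL_psiLS_phiSL :
    residueNumerator a p (OpenString.phiBarLL.pencil p q P₁ P₄) (OpenString.psiLS.pencil q r Q₁ Q₄)
      (OpenString.phiSL.pencil r p R₁ R₄) =
    -numeratorForm a p q r (-P₁) P₄ (p 0 * q 0 * (Q₁ * R₁) - p 1 * q 1 * (Q₄ * R₄))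
      (p 0 * q 1 * (Q₁ * R₄) - p 1 * q 0 * (Q₄ * R₁)) (r 0) (r 1) := by
  simp only [residueNumerator, wedgePencil, OpenString.pencil, OpenString.constPart,
    OpenString.xPart, OpenString.yPart, coeff_four_zero_superTrace, coeff_zero_four_superTrace,
    coeff_two_two_superTrace, fromBlocks_multiply, fromBlocks_add, mul_fin_two, zero_add,
    add_zero, scalarSuperTrace_fromBlocks, trace_fin_two_of, trace_add, mul_zero, zero_mul,
    numeratorForm, Matrix.mul_add]
  ring

lemma residueNumerator_phiBarLL_phiLS_psiSL :
    residueNumerator a p (OpenString.phiBarLL.pencil p q P₁ P₄) (OpenString.phiLS.pencil q r Q₁ Q₄)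
      (OpenString.psiSL.pencil r p R₁ R₄) =
    -numeratorForm a p q r (-P₁) P₄ (p 0 * q 0 * (Q₁ * R₁) + p 1 * q 1 * (Q₄ * R₄))
      (p 0 * q 1 * (Q₁ * R₄) + p 1 * q 0 * (Q₄ * R₁)) (r 0) (r 1) := by
  simp only [residueNumerator, wedgePencil, OpenString.pencil, OpenString.constPart,
    OpenString.xPart, OpenString.yPart, coeff_four_zero_superTrace, coeff_zero_four_superTrace,
    coeff_two_two_superTrace, fromBlocks_multiply, fromBlocks_add, mul_fin_two, zero_add,
    add_zero, scalarSuperTrace_fromBlocks, trace_fin_two_of, trace_add, mul_zero, zero_mul,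
    numeratorForm, Matrix.mul_add]
  ring

end Numerators

/-- The numerator collapses to a monomial when `P₁, P₄` obey the addition formulas with companions
`M₁, M₄` and `A₁, A₂` obey Riemann relations with the common factor `S`, which becomes the value of
the correlator. -/
lemma numeratorForm_eq {a t S M₁ M₄ P₁ P₄ A₁ A₂ ρ₁ ρ₂ : ℂ} {p q : Fin 3 → ℂ} (r : Fin 3 → ℂ)
    (hp : p 0 ^ 4 + p 1 ^ 4 - p 2 ^ 2 - a * p 0 ^ 2 * p 1 ^ 2 = 0)
    (h₁₄ : t ^ 2 * (P₁ * M₄) = p 2 * q 0 * q 1 + q 2 * p 0 * p 1)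
    (h₄₁ : t ^ 2 * (P₄ * M₁) = q 2 * p 0 * p 1 - p 2 * q 0 * q 1)
    (h₄₄ : t ^ 2 * (P₄ * M₄) = p 1 ^ 2 * q 1 ^ 2 - p 0 ^ 2 * q 0 ^ 2)
    (h₁₁ : t ^ 2 * (P₁ * M₁) = p 0 ^ 2 * q 1 ^ 2 - p 1 ^ 2 * q 0 ^ 2)
    (hA₁ : A₁ = t * S * (ρ₂ * M₄)) (hA₂ : A₂ = -(t * S * (ρ₁ * M₁))) :
    t * numeratorForm a p q r P₁ P₄ A₁ A₂ ρ₁ ρ₂ =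
      -(8 * (a ^ 2 - 4) * (p 0 ^ 2 * p 1 ^ 2 * p 2) ^ 2 * (q 0 ^ 2 * q 1 ^ 2 * q 2) *
        (r 0 * r 1 * r 2 * (ρ₁ * ρ₂)) * S) := by
  set κ := p 0 ^ 4 + p 1 ^ 4 + a * p 0 ^ 2 * p 1 ^ 2 with hκ
  set μ := p 0 ^ 4 - p 1 ^ 4 with hμ
  have key : p 2 ^ 2 * κ - μ ^ 2 = -((a ^ 2 - 4) * p 0 ^ 4 * p 1 ^ 4) := by
    rw [hκ, hμ]
    linear_combination (-(p 0 ^ 4 + p 1 ^ 4 + a * p 0 ^ 2 * p 1 ^ 2)) * hp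
  have expand : t * numeratorForm a p q r P₁ P₄ A₁ A₂ ρ₁ ρ₂ =
      4 * p 2 ^ 2 * q 2 * r 0 * r 1 * r 2 * (ρ₁ * ρ₂) * S *
        ((t ^ 2 * (P₁ * M₄)) * (p 2 * κ * q 0 * q 1) +
          (t ^ 2 * (P₄ * M₄)) * (μ * (p 0 ^ 2 * q 1 ^ 2 + p 1 ^ 2 * q 0 ^ 2)) -
          (t ^ 2 * (P₁ * M₁)) * (μ * (p 0 ^ 2 * q 0 ^ 2 + p 1 ^ 2 * q 1 ^ 2)) -
          (t ^ 2 * (P₄ * M₁)) * (p 2 * κ * q 0 * q 1)) := by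
    rw [numeratorForm, hA₁, hA₂]
    ring
  rw [expand, h₁₄, h₄₁, h₄₄, h₁₁]
  linear_combination (8 * p 2 ^ 2 * q 0 ^ 2 * q 1 ^ 2 * q 2 * r 0 * r 1 * r 2 * (ρ₁ * ρ₂) * S) * key

/-! ### The uniformized parameters -/

section Alpha

variable {τ : ℂ}

lemma alpha_neg_zero (u : ℂ) : alpha τ (-u) 0 = -alpha τ u 0 := by
  simp [alpha, Theta1_neg]

lemma alpha_neg_one (u : ℂ) : alpha τ (-u) 1 = alpha τ u 1 := by
  simp [alpha, Theta4_neg]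

lemma alpha_neg_two (u : ℂ) : alpha τ (-u) 2 = alpha τ u 2 := by
  simp [alpha, Theta2_neg, Theta3_neg]

lemma Theta2_zero_ne_zero {u : ℂ} (hu : IsGeneric τ u) : Theta2 0 (2 * τ) ≠ 0 := fun h =>
  hu 2 (by simp [alpha, h])

lemma Theta3_zero_ne_zero {u : ℂ} (hu : IsGeneric τ u) : Theta3 0 (2 * τ) ≠ 0 := fun h =>
  hu 2 (by simp [alpha, h])

lemma Theta4_zero_ne_zero {u : ℂ} (hu : IsGeneric τ u) : Theta4 0 (2 * τ) ≠ 0 := fun h =>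
  hu 2 (by simp [alpha, h])

variable (hτ : 0 < τ.im)
include hτ

lemma two_mul_im_pos : 0 < (2 * τ).im := by
  simpa using hτ

lemma differentiable_alpha (j : Fin 3) : Differentiable ℂ (alpha τ · j) := by
  have h := two_mul_im_pos hτ
  have hl : Differentiable ℂ fun u : ℂ => 2 * u := by fun_prop
  fin_cases j
  · exact (differentiable_Theta1 h).comp hl
  · exact (differentiable_Theta4 h).comp hl
  · exact (((differentiable_Theta2 h).comp hl).mul ((differentiable_Theta3 h).comp hl)).const_mul _

lemma bulkParam_sq_sub_four_ne_zero {u : ℂ} (hu : IsGeneric τ u) : bulkParam τ ^ 2 - 4 ≠ 0 := by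
  have h2 := Theta2_zero_ne_zero hu
  have h3 := Theta3_zero_ne_zero hu
  have h := Theta3_zero_pow_four (two_mul_im_pos hτ)
  have : bulkParam τ ^ 2 - 4 =
      Theta4 0 (2 * τ) ^ 8 / (Theta2 0 (2 * τ) ^ 4 * Theta3 0 (2 * τ) ^ 4) := by
    rw [bulkParam]
    field_simp
    linear_combination (Theta3 0 (2 * τ) ^ 4 - Theta2 0 (2 * τ) ^ 4 + Theta4 0 (2 * τ) ^ 4) * h
  rw [this]
  have h4 := Theta4_zero_ne_zero hu
  positivity

lemma alpha_curve {u : ℂ} (hu : IsGeneric τ u) :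
    alpha τ u 0 ^ 4 + alpha τ u 1 ^ 4 - alpha τ u 2 ^ 2 -
      bulkParam τ * alpha τ u 0 ^ 2 * alpha τ u 1 ^ 2 = 0 := by
  have h2 := Theta2_zero_ne_zero hu
  have h3 := Theta3_zero_ne_zero hu
  have h := theta_quartic (two_mul_im_pos hτ) (2 * u)
  simp only [alpha, bulkParam, Matrix.cons_val]
  field_simp
  linear_combination h

/-- The first of the addition formulas that write the polynomials occurring in the state matrices
as products of theta functions. The prefactor of `α₃` turns the `θ₂(0) θ₃(0)` of
`Theta1_mul_Theta4_add_sub` into `θ₄(0)²`. -/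
lemma alpha_add_sub_one_four {u : ℂ} (hu : IsGeneric τ u) (v : ℂ) :
    Theta4 0 (2 * τ) ^ 2 * (Theta1 (2 * (u + v)) (2 * τ) * Theta4 (2 * (u - v)) (2 * τ)) =
      alpha τ u 2 * alpha τ v 0 * alpha τ v 1 + alpha τ v 2 * alpha τ u 0 * alpha τ u 1 := by
  have h2 := Theta2_zero_ne_zero hu
  have h3 := Theta3_zero_ne_zero hu
  have h := Theta1_mul_Theta4_add_sub (two_mul_im_pos hτ) (2 * u) (2 * v)
  rw [← mul_add 2, ← mul_sub 2] at h
  simp only [alpha, Matrix.cons_val]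
  field_simp
  linear_combination (Theta4 0 (2 * τ) ^ 2) * h

lemma alpha_add_sub_four_one {u : ℂ} (hu : IsGeneric τ u) (v : ℂ) :
    Theta4 0 (2 * τ) ^ 2 * (Theta4 (2 * (u + v)) (2 * τ) * Theta1 (2 * (u - v)) (2 * τ)) =
      alpha τ v 2 * alpha τ u 0 * alpha τ u 1 - alpha τ u 2 * alpha τ v 0 * alpha τ v 1 := by
  have h := alpha_add_sub_one_four hτ hu (-v)
  rw [alpha_neg_zero, alpha_neg_one, alpha_neg_two, ← sub_eq_add_neg, sub_neg_eq_add] at h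
  linear_combination h

lemma alpha_add_sub_four_four (u v : ℂ) :
    Theta4 0 (2 * τ) ^ 2 * (Theta4 (2 * (u + v)) (2 * τ) * Theta4 (2 * (u - v)) (2 * τ)) =
      alpha τ u 1 ^ 2 * alpha τ v 1 ^ 2 - alpha τ u 0 ^ 2 * alpha τ v 0 ^ 2 := by
  have h := Theta4_mul_Theta4_add_sub (two_mul_im_pos hτ) (2 * u) (2 * v)
  simpa only [alpha, Matrix.cons_val, mul_add, mul_sub] using h

lemma alpha_add_sub_one_one (u v : ℂ) :
    Theta4 0 (2 * τ) ^ 2 * (Theta1 (2 * (u + v)) (2 * τ) * Theta1 (2 * (u - v)) (2 * τ)) =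
      alpha τ u 0 ^ 2 * alpha τ v 1 ^ 2 - alpha τ u 1 ^ 2 * alpha τ v 0 ^ 2 := by
  have h := Theta1_mul_Theta1_add_sub (two_mul_im_pos hτ) (2 * u) (2 * v)
  simpa only [alpha, Matrix.cons_val, mul_add, mul_sub] using h

/-- The numerator in the sector `fbb`, evaluated at theta functions; the other sectors follow by
changing the signs of `v` and `w`. -/
lemma numeratorForm_theta_one {u : ℂ} (hu : IsGeneric τ u) (v w : ℂ) :
    Theta4 0 (2 * τ) * numeratorForm (bulkParam τ) (alpha τ u) (alpha τ v) (alpha τ w)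
      (Theta1 (2 * (u + v)) (2 * τ)) (Theta4 (2 * (u + v)) (2 * τ))
      (alpha τ u 1 * alpha τ v 1 *
          (Theta1 (2 * (v + w)) (2 * τ) * Theta1 (2 * (w + u)) (2 * τ)) -
        alpha τ u 0 * alpha τ v 0 *
          (Theta4 (2 * (v + w)) (2 * τ) * Theta4 (2 * (w + u)) (2 * τ)))
      (alpha τ u 1 * alpha τ v 0 *
          (Theta1 (2 * (v + w)) (2 * τ) * Theta4 (2 * (w + u)) (2 * τ)) -
        alpha τ u 0 * alpha τ v 1 *
          (Theta4 (2 * (v + w)) (2 * τ) * Theta1 (2 * (w + u)) (2 * τ)))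
      (alpha τ w 1) (alpha τ w 0) =
    -(8 * (bulkParam τ ^ 2 - 4) * (alpha τ u 0 ^ 2 * alpha τ u 1 ^ 2 * alpha τ u 2) ^ 2 *
      (alpha τ v 0 ^ 2 * alpha τ v 1 ^ 2 * alpha τ v 2) *
      (alpha τ w 0 ^ 2 * alpha τ w 1 ^ 2 * alpha τ w 2) *
      Theta1 (2 * (u + v + w)) (2 * τ)) := by
  have h₁ := riemann_relation_one_same (two_mul_im_pos hτ) (2 * u) (2 * v) (2 * w)
  have h₂ := riemann_relation_one_mixed (two_mul_im_pos hτ) (2 * u) (2 * v) (2 * w)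
  simp only [← mul_add, ← mul_sub] at h₁ h₂
  exact (numeratorForm_eq (alpha τ w) (alpha_curve hτ hu) (alpha_add_sub_one_four hτ hu v)
    (alpha_add_sub_four_one hτ hu v) (alpha_add_sub_four_four hτ u v)
    (alpha_add_sub_one_one hτ u v) (S := Theta1 (2 * (u + v + w)) (2 * τ))
    (ρ₁ := alpha τ w 1) (ρ₂ := alpha τ w 0) h₁ h₂).trans (by ring)

/-- The numerator of the second correlator in the sector `fbb`, up to sign, evaluated at theta
functions. -/
lemma numeratorForm_theta_four {u : ℂ} (hu : IsGeneric τ u) (v w : ℂ) :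
    Theta4 0 (2 * τ) * numeratorForm (bulkParam τ) (alpha τ u) (alpha τ v) (alpha τ w)
      (Theta1 (2 * (u + v)) (2 * τ)) (Theta4 (2 * (u + v)) (2 * τ))
      (alpha τ u 0 * alpha τ v 0 *
          (Theta1 (2 * (v + w)) (2 * τ) * Theta1 (2 * (w + u)) (2 * τ)) -
        alpha τ u 1 * alpha τ v 1 *
          (Theta4 (2 * (v + w)) (2 * τ) * Theta4 (2 * (w + u)) (2 * τ)))
      (alpha τ u 0 * alpha τ v 1 *
          (Theta1 (2 * (v + w)) (2 * τ) * Theta4 (2 * (w + u)) (2 * τ)) -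
        alpha τ u 1 * alpha τ v 0 *
          (Theta4 (2 * (v + w)) (2 * τ) * Theta1 (2 * (w + u)) (2 * τ)))
      (alpha τ w 0) (alpha τ w 1) =
    8 * (bulkParam τ ^ 2 - 4) * (alpha τ u 0 ^ 2 * alpha τ u 1 ^ 2 * alpha τ u 2) ^ 2 *
      (alpha τ v 0 ^ 2 * alpha τ v 1 ^ 2 * alpha τ v 2) *
      (alpha τ w 0 ^ 2 * alpha τ w 1 ^ 2 * alpha τ w 2) *
      Theta4 (2 * (u + v + w)) (2 * τ) := by
  have h₁ := riemann_relation_four_same (two_mul_im_pos hτ) (2 * u) (2 * v) (2 * w)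
  have h₂ := riemann_relation_four_mixed (two_mul_im_pos hτ) (2 * u) (2 * v) (2 * w)
  simp only [← mul_add, ← mul_sub] at h₁ h₂
  exact (numeratorForm_eq (alpha τ w) (alpha_curve hτ hu) (alpha_add_sub_one_four hτ hu v)
    (alpha_add_sub_four_one hτ hu v) (alpha_add_sub_four_four hτ u v)
    (alpha_add_sub_one_one hτ u v) (S := -Theta4 (2 * (u + v + w)) (2 * τ))
    (by simp only [alpha, Matrix.cons_val]; linear_combination -h₁)
    (by simp only [alpha, Matrix.cons_val]; linear_combination h₂)).trans (by ring)

end Alpha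

/-! ### The normalization factors -/

namespace OpenString

/-- The combination of boundary moduli on which the two factors `θ₁`, `θ₄` depend that are left
in a state matrix when the normalization factor is split off. -/
def momentum : OpenString → ℂ → ℂ → ℂ
  | psiLL, u, v | psiBarLL, u, v | phiLS, u, v | phiSL, u, v => u + v
  | phiLL, u, v | phiBarLL, u, v | psiLS, u, v | psiSL, u, v => u - v

/-- The common theta function of the two factors of a state matrix. -/
def commonTheta (τ : ℂ) : OpenString → ℂ → ℂ → ℂ
  | psiLL, u, v | psiBarLL, u, v => Theta4 (2 * (u - v)) (2 * τ)
  | phiLL, u, v | phiBarLL, u, v => Theta1 (2 * (u + v)) (2 * τ)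
  | psiLS, u, v | psiSL, u, v => Theta4 (2 * (u + v)) (2 * τ)
  | phiLS, u, v | phiSL, u, v => Theta1 (2 * (u - v)) (2 * τ)

/-- The power of `θ₄(0)` in the normalization factor. Each of the three states contributes
`θ₄(0)²` through its addition formula, and one power of `θ₄(0)` is lost in the evaluation of the
correlator; the loss is assigned to the long-long state. -/
def nullExponent : OpenString → ℕ
  | psiLL | psiBarLL | phiLL | phiBarLL => 1
  | psiLS | phiLS | psiSL | phiSL => 2

/-- The normalization factor of a state: the scalar that is split off from its matrix, times
`α₁²α₂²α₃` of the first brane. The latter three factors, one for each brane of a correlator, come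
from the common denominator of `(∂Q)^{∧3}` and from the evaluation of the residue. -/
def norm (ψ : OpenString) (τ u v : ℂ) : ℂ :=
  alpha τ u 0 ^ 2 * alpha τ u 1 ^ 2 * alpha τ u 2 * ψ.scale (alpha τ u) (alpha τ v) *
    Theta4 0 (2 * τ) ^ ψ.nullExponent * ψ.commonTheta τ u v

/-- The rescaled state matrix at theta functions of the momentum. -/
def thetaPencil (ψ : OpenString) (τ u v : ℂ) : SuperMatrix :=
  ψ.pencil (alpha τ u) (alpha τ v) (Theta1 (2 * ψ.momentum u v) (2 * τ))
    (Theta4 (2 * ψ.momentum u v) (2 * τ))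

/-- The addition formulas in terms of the states. -/
lemma factors_eq (ψ : OpenString) {τ u : ℂ} (hτ : 0 < τ.im) (hu : IsGeneric τ u) (v : ℂ) :
    ψ.oddFactor (alpha τ u) (alpha τ v) =
        Theta4 0 (2 * τ) ^ 2 * ψ.commonTheta τ u v * Theta1 (2 * ψ.momentum u v) (2 * τ) ∧
      ψ.evenFactor (alpha τ u) (alpha τ v) =
        Theta4 0 (2 * τ) ^ 2 * ψ.commonTheta τ u v * Theta4 (2 * ψ.momentum u v) (2 * τ) := by
  have h₁₁ := alpha_add_sub_one_one hτ u v
  have h₁₄ := alpha_add_sub_one_four hτ hu v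
  have h₄₁ := alpha_add_sub_four_one hτ hu v
  have h₄₄ := alpha_add_sub_four_four hτ u v
  constructor
  · cases ψ <;> simp only [oddFactor, momentum, commonTheta] <;>
      first
        | linear_combination -h₁₁
        | linear_combination -h₁₄
        | linear_combination -h₄₁
  · cases ψ <;> simp only [evenFactor, momentum, commonTheta] <;>
      first
        | linear_combination -h₄₄
        | linear_combination -h₁₄
        | linear_combination -h₄₁

lemma mat_alpha (ψ : OpenString) {τ u v : ℂ} (hτ : 0 < τ.im) (hu : IsGeneric τ u)
    (hv : IsGeneric τ v) : ψ.mat (alpha τ u) (alpha τ v) =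
      (ψ.scale (alpha τ u) (alpha τ v) * (Theta4 0 (2 * τ) ^ 2 * ψ.commonTheta τ u v)) •
        ψ.thetaPencil τ u v := by
  rw [mat_eq_pencil ψ hu hv, (factors_eq ψ hτ hu v).1, (factors_eq ψ hτ hu v).2, pencil_smul,
    smul_smul, thetaPencil]

lemma scale_ne_zero (ψ : OpenString) {p q : Fin 3 → ℂ} (hp : ∀ i, p i ≠ 0)
    (hq : ∀ i, q i ≠ 0) : ψ.scale p q ≠ 0 := by
  cases ψ <;> simp [scale, hp, hq]

lemma eq_zero_of_linPencil_eq_zero {K A B : ScalarMatrix} (h : linPencil K A B = 0) :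
    K = 0 ∧ A = 0 ∧ B = 0 := by
  have e : ∀ (i j) (x : Fin 3 → ℂ), K i j + x 0 * A i j + x 1 * B i j = 0 := by
    intro i j x
    simpa [linPencil, constMatrix, mono_eq] using congrArg (eval x) (congrFun₂ h i j)
  refine ⟨?_, ?_, ?_⟩ <;> ext i j <;>
    have h0 := e i j 0 <;> have h1 := e i j ![1, 0, 0] <;> have h2 := e i j ![0, 1, 0] <;>
    simp at h0 h1 h2 <;> simp_all

lemma eq_zero_of_pencil_eq_zero (ψ : OpenString) {p q : Fin 3 → ℂ} {s t : ℂ}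
    (hp : ∀ i, p i ≠ 0) (hq : ∀ i, q i ≠ 0) (h : ψ.pencil p q s t = 0) : s = 0 ∧ t = 0 := by
  obtain ⟨hK, hA, hB⟩ := eq_zero_of_linPencil_eq_zero h
  have f : ∀ {M : ScalarMatrix}, M = 0 → ∀ i j, M i j = 0 := fun h i j => congrFun₂ h i j
  cases ψ
  case psiLL | phiBarLL | psiBarLL | phiLL =>
    have a1 := f hA (.inl 0) (.inr 0)
    have a2 := f hA (.inl 0) (.inr 1)
    have a3 := f hA (.inl 0) (.inl 0)
    have a4 := f hA (.inl 0) (.inl 1)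
    have b1 := f hB (.inl 0) (.inr 0)
    have b2 := f hB (.inl 0) (.inr 1)
    have b3 := f hB (.inl 0) (.inl 0)
    have b4 := f hB (.inl 0) (.inl 1)
    simp_all [xPart, yPart]
  all_goals
    have a1 := f hK (.inl 0) (.inr 0)
    have a2 := f hK (.inl 1) (.inr 0)
    have a3 := f hK (.inl 0) (.inr 1)
    have a4 := f hK (.inl 0) (.inl 0)
    have a5 := f hK (.inl 1) (.inl 1)
    have a6 := f hK (.inl 0) (.inl 1)
    simp_all [constPart]

/-- By the addition formulas, a common zero of `θ₁` and `θ₄` at one of `u ± v` would make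
`α₁(u) α₂(u) α₃(v)` vanish. -/
lemma Theta1_ne_zero_or_Theta4_ne_zero {τ u v : ℂ} (hτ : 0 < τ.im) (hu : IsGeneric τ u)
    (hv : IsGeneric τ v) (ψ : OpenString) : ¬ (Theta1 (2 * ψ.momentum u v) (2 * τ) = 0 ∧
      Theta4 (2 * ψ.momentum u v) (2 * τ) = 0) := by
  rintro ⟨h₁, h₄⟩
  have h₁₄ := alpha_add_sub_one_four hτ hu v
  have h₄₁ := alpha_add_sub_four_one hτ hu v
  -- Either way both `p₃q₁q₂ + q₃p₁p₂` and `q₃p₁p₂ - p₃q₁q₂` vanish, hence so does `q₃p₁p₂`.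
  have : alpha τ v 2 * alpha τ u 0 * alpha τ u 1 = 0 := by
    cases ψ <;> simp only [momentum] at h₁ h₄ <;>
      simp only [h₁, h₄, mul_zero, zero_mul] at h₁₄ h₄₁ <;>
      linear_combination (-1 / 2) * h₁₄ - (1 / 2) * h₄₁
  simp [hu _, hv _] at this

lemma norm_eq_zero_iff (ψ : OpenString) {τ u v : ℂ} (hτ : 0 < τ.im) (hu : IsGeneric τ u)
    (hv : IsGeneric τ v) : ψ.norm τ u v = 0 ↔ ψ.mat (alpha τ u) (alpha τ v) = 0 := by
  -- The matrix is `norm`, up to nonzero factors, times a nonzero matrix.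
  have hp : ψ.thetaPencil τ u v ≠ 0 := fun h =>
    Theta1_ne_zero_or_Theta4_ne_zero hτ hu hv ψ (eq_zero_of_pencil_eq_zero ψ hu hv h)
  rw [mat_alpha ψ hτ hu hv, smul_eq_zero, or_iff_left hp]
  simp [norm, hu _, scale_ne_zero ψ hu hv, Theta4_zero_ne_zero hu]

lemma differentiableAt_scale (ψ : OpenString) {E : Type*} [NormedAddCommGroup E]
    [NormedSpace ℂ E] {p q : E → Fin 3 → ℂ} {x : E}
    (hp : ∀ j, DifferentiableAt ℂ (fun z => p z j) x)
    (hq : ∀ j, DifferentiableAt ℂ (fun z => q z j) x) (hp0 : ∀ j, p x j ≠ 0)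
    (hq0 : ∀ j, q x j ≠ 0) : DifferentiableAt ℂ (fun z => ψ.scale (p z) (q z)) x := by
  have p0 := hp 0
  have p1 := hp 1
  have p2 := hp 2
  have q0 := hq 0
  have q1 := hq 1
  have q2 := hq 2
  cases ψ <;> simp only [scale, div_eq_mul_inv] <;>
    refine DifferentiableAt.fun_mul ?_ (DifferentiableAt.fun_inv ?_ ?_) <;>
      first
        | fun_prop
        | simp [hp0, hq0]

lemma differentiable_commonTheta (ψ : OpenString) {τ : ℂ} (hτ : 0 < τ.im) :
    Differentiable ℂ (fun z : ℂ × ℂ => ψ.commonTheta τ z.1 z.2) := by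
  have hadd : Differentiable ℂ (fun z : ℂ × ℂ => 2 * (z.1 + z.2)) := by fun_prop
  have hsub : Differentiable ℂ (fun z : ℂ × ℂ => 2 * (z.1 - z.2)) := by fun_prop
  have d₁ := differentiable_Theta1 (two_mul_im_pos hτ)
  have d₄ := differentiable_Theta4 (two_mul_im_pos hτ)
  cases ψ
  case psiLL | psiBarLL => exact d₄.comp hsub
  case phiLL | phiBarLL => exact d₁.comp hadd
  case psiLS | psiSL => exact d₄.comp hadd
  case phiLS | phiSL => exact d₁.comp hsub

lemma differentiableAt_norm (ψ : OpenString) {τ u v : ℂ} (hτ : 0 < τ.im) (hu : IsGeneric τ u)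
    (hv : IsGeneric τ v) : DifferentiableAt ℂ (fun z : ℂ × ℂ => ψ.norm τ z.1 z.2) (u, v) := by
  have hp : ∀ j, Differentiable ℂ (fun z : ℂ × ℂ => alpha τ z.1 j) := fun j =>
    Differentiable.comp (g := fun w => alpha τ w j) (differentiable_alpha hτ j) differentiable_fst
  have hq : ∀ j, Differentiable ℂ (fun z : ℂ × ℂ => alpha τ z.2 j) := fun j =>
    Differentiable.comp (g := fun w => alpha τ w j) (differentiable_alpha hτ j) differentiable_snd
  have hs := differentiableAt_scale ψ (fun j => hp j (u, v)) (fun j => hq j (u, v)) hu hv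
  have hc := differentiable_commonTheta ψ hτ (u, v)
  exact ((((((hp 0 _).pow 2).mul ((hp 1 _).pow 2)).mul (hp 2 _)).mul hs).mul_const _).mul hc

end OpenString

/-! ### The correlators of the B-model -/


lemma superTrace_complex_smul (c : ℂ) (M : SuperMatrix) :
    superTrace (c • M) = c • superTrace M := by
  rw [← algebraMap_smul Poly c M, superTrace_smul, algebraMap_eq, C_mul']

/-- The three-point functions in terms of the numerator of the residue. -/
lemma isThreePoint_of_numerator {τ u v w c : ℂ} (hτ : 0 < τ.im) (hu : IsGeneric τ u)
    (hv : IsGeneric τ v) (hw : IsGeneric τ w) {ψ₁ ψ₂ ψ₃ : OpenString} (h₁ : ψ₁.source = .long)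
    (e₁ : ψ₁.nullExponent = 1) (e₂ : ψ₂.nullExponent = 2) (e₃ : ψ₃.nullExponent = 2)
    (h : Theta4 0 (2 * τ) * residueNumerator (bulkParam τ) (alpha τ u) (ψ₁.thetaPencil τ u v)
        (ψ₂.thetaPencil τ v w) (ψ₃.thetaPencil τ w u) =
      8 * (bulkParam τ ^ 2 - 4) * (alpha τ u 0 ^ 2 * alpha τ u 1 ^ 2 * alpha τ u 2) ^ 2 *
        (alpha τ v 0 ^ 2 * alpha τ v 1 ^ 2 * alpha τ v 2) *
        (alpha τ w 0 ^ 2 * alpha τ w 1 ^ 2 * alpha τ w 2) * c) :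
    IsThreePoint τ ψ₁ ψ₂ ψ₃ u v w
      (ψ₁.norm τ u v * ψ₂.norm τ v w * ψ₃.norm τ w u * c) := by
  have ha := bulkParam_sq_sub_four_ne_zero hτ hu
  have ht := Theta4_zero_ne_zero hu
  have hu0 := hu 0
  have hu1 := hu 1
  have hu2 := hu 2
  have hres := isGrothendieckResidue_superpotential ha (superTrace
    (wedgeDerivative (ψ₁.source.Q (alpha τ u)) * ψ₁.mat (alpha τ u) (alpha τ v) *
      ψ₂.mat (alpha τ v) (alpha τ w) * ψ₃.mat (alpha τ w) (alpha τ u)))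
  rw [IsThreePoint, IsDiskCorrelator]
  convert hres using 1
  clear hres
  rw [h₁, wedgeDerivative_long hu0 hu1 hu2, ψ₁.mat_alpha hτ hu hv, ψ₂.mat_alpha hτ hv hw,
    ψ₃.mat_alpha hτ hw hu]
  simp only [smul_mul_assoc, mul_smul_comm, smul_smul, superTrace_complex_smul, coeff_smul,
    smul_eq_mul]
  set G := residueNumerator (bulkParam τ) (alpha τ u) (ψ₁.thetaPencil τ u v)
        (ψ₂.thetaPencil τ v w) (ψ₃.thetaPencil τ w u) with hG
  simp only [residueNumerator] at hG
  rw [eq_div_iff (by simpa using ha)]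
  simp only [OpenString.norm, e₁, e₂, e₃]
  set κ := 2 / (alpha τ u 0 ^ 2 * alpha τ u 1 ^ 2 * alpha τ u 2) with hκ
  have hw : κ * (alpha τ u 0 ^ 2 * alpha τ u 1 ^ 2 * alpha τ u 2) ^ 2 =
      2 * (alpha τ u 0 ^ 2 * alpha τ u 1 ^ 2 * alpha τ u 2) := by
    rw [hκ]
    field_simp
  set K := ψ₁.scale (alpha τ u) (alpha τ v) * ψ₁.commonTheta τ u v *
    (ψ₂.scale (alpha τ v) (alpha τ w) * ψ₂.commonTheta τ v w) *
    (ψ₃.scale (alpha τ w) (alpha τ u) * ψ₃.commonTheta τ w u) with hK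
  clear_value κ
  linear_combination (-(K * Theta4 0 (2 * τ) ^ 5 * κ)) * h -
    (K * Theta4 0 (2 * τ) ^ 5 * 8 * (bulkParam τ ^ 2 - 4) *
      (alpha τ v 0 ^ 2 * alpha τ v 1 ^ 2 * alpha τ v 2) *
      (alpha τ w 0 ^ 2 * alpha τ w 1 ^ 2 * alpha τ w 2) * c) * hw +
    (K * Theta4 0 (2 * τ) ^ 6 * κ) * hG

namespace Sector

/-- The sign of the correlator with value `θ₁`. -/
def sign : Sector → ℤˣ
  | fff | fbb => -1
  | bfb | bbf => 1

/-- The sign of the correlator with value `θ₄`. -/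
def signBar : Sector → ℤˣ
  | fff | bbf => 1
  | fbb | bfb => -1

end Sector

lemma isThreePoint_theta_one (s : Sector) {τ u v w : ℂ} (hτ : 0 < τ.im) (hu : IsGeneric τ u)
    (hv : IsGeneric τ v) (hw : IsGeneric τ w) :
    IsThreePoint τ s.longLong s.longShort s.shortLong u v w
      ((s.sign : ℤ) * (s.longLong.norm τ u v * s.longShort.norm τ v w * s.shortLong.norm τ w u) *
        Theta1 (2 * s.modulus u v w) (2 * τ)) := by
  rw [mul_comm ((s.sign : ℤ) : ℂ), mul_assoc]
  apply isThreePoint_of_numerator hτ hu hv hw <;> try (cases s <;> rfl)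
  -- A change of the sign of `v` or `w` turns the numerators of the four sectors into each
  -- other, up to sign.
  have e₁ : 2 * (-w + u) = -(2 * (w - u)) := by ring
  have e₂ : 2 * (-v + w) = -(2 * (v - w)) := by ring
  have e₃ : 2 * (-v + -w) = -(2 * (v + w)) := by ring
  cases s
  case fff =>
    have h := numeratorForm_theta_one hτ hu v (-w)
    simp only [e₁, ← sub_eq_add_neg, numeratorForm, alpha_neg_zero, alpha_neg_one, alpha_neg_two,
      Theta1_neg, Theta4_neg] at h
    simp only [Sector.longLong, Sector.longShort, Sector.shortLong, OpenString.thetaPencil,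
      OpenString.momentum, residueNumerator_psiLL_psiLS_psiSL, Sector.sign, Sector.modulus,
      numeratorForm]
    push_cast
    linear_combination h
  case fbb =>
    have h := numeratorForm_theta_one hτ hu v w
    simp only [Sector.longLong, Sector.longShort, Sector.shortLong, OpenString.thetaPencil,
      OpenString.momentum, residueNumerator_psiLL_phiLS_phiSL, Sector.sign, Sector.modulus]
    push_cast
    linear_combination h
  case bfb =>
    have h := numeratorForm_theta_one hτ hu (-v) w
    simp only [e₂, ← sub_eq_add_neg, numeratorForm, alpha_neg_zero, alpha_neg_one, alpha_neg_two,
      Theta1_neg, Theta4_neg] at h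
    simp only [Sector.longLong, Sector.longShort, Sector.shortLong, OpenString.thetaPencil,
      OpenString.momentum, residueNumerator_phiLL_psiLS_phiSL, Sector.sign, Sector.modulus,
      numeratorForm]
    push_cast
    linear_combination -h
  case bbf =>
    have h := numeratorForm_theta_one hτ hu (-v) (-w)
    simp only [e₁, e₃, numeratorForm, alpha_neg_zero, alpha_neg_one, alpha_neg_two,
      Theta1_neg, Theta4_neg] at h
    simp only [← sub_eq_add_neg] at h
    simp only [Sector.longLong, Sector.longShort, Sector.shortLong, OpenString.thetaPencil,
      OpenString.momentum, residueNumerator_phiLL_phiLS_psiSL, Sector.sign, Sector.modulus,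
      numeratorForm]
    push_cast
    linear_combination -h

lemma isThreePoint_theta_four (s : Sector) {τ u v w : ℂ} (hτ : 0 < τ.im) (hu : IsGeneric τ u)
    (hv : IsGeneric τ v) (hw : IsGeneric τ w) :
    IsThreePoint τ s.longLongBar s.longShort s.shortLong u v w
      ((s.signBar : ℤ) *
        (s.longLongBar.norm τ u v * s.longShort.norm τ v w * s.shortLong.norm τ w u) *
        Theta4 (2 * s.modulus u v w) (2 * τ)) := by
  rw [mul_comm ((s.signBar : ℤ) : ℂ), mul_assoc]
  apply isThreePoint_of_numerator hτ hu hv hw <;> try (cases s <;> rfl)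
  have e₁ : 2 * (-w + u) = -(2 * (w - u)) := by ring
  have e₂ : 2 * (-v + w) = -(2 * (v - w)) := by ring
  have e₃ : 2 * (-v + -w) = -(2 * (v + w)) := by ring
  cases s
  case fff =>
    have h := numeratorForm_theta_four hτ hu v (-w)
    simp only [e₁, ← sub_eq_add_neg, numeratorForm, alpha_neg_zero, alpha_neg_one, alpha_neg_two,
      Theta1_neg, Theta4_neg] at h
    simp only [Sector.longLongBar, Sector.longShort, Sector.shortLong, OpenString.thetaPencil,
      OpenString.momentum, residueNumerator_psiBarLL_psiLS_psiSL, Sector.signBar, Sector.modulus,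
      numeratorForm]
    push_cast
    linear_combination h
  case fbb =>
    have h := numeratorForm_theta_four hτ hu v w
    simp only [Sector.longLongBar, Sector.longShort, Sector.shortLong, OpenString.thetaPencil,
      OpenString.momentum, residueNumerator_psiBarLL_phiLS_phiSL, Sector.signBar, Sector.modulus]
    push_cast
    linear_combination -h
  case bfb =>
    have h := numeratorForm_theta_four hτ hu (-v) w
    simp only [e₂, ← sub_eq_add_neg, numeratorForm, alpha_neg_zero, alpha_neg_one, alpha_neg_two,
      Theta1_neg, Theta4_neg] at h
    simp only [Sector.longLongBar, Sector.longShort, Sector.shortLong, OpenString.thetaPencil,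
      OpenString.momentum, residueNumerator_phiBarLL_psiLS_phiSL, Sector.signBar, Sector.modulus,
      numeratorForm]
    push_cast
    linear_combination -h
  case bbf =>
    have h := numeratorForm_theta_four hτ hu (-v) (-w)
    simp only [e₁, e₃, numeratorForm, alpha_neg_zero, alpha_neg_one, alpha_neg_two,
      Theta1_neg, Theta4_neg] at h
    simp only [← sub_eq_add_neg] at h
    simp only [Sector.longLongBar, Sector.longShort, Sector.shortLong, OpenString.thetaPencil,
      OpenString.momentum, residueNumerator_phiBarLL_phiLS_psiSL, Sector.signBar, Sector.modulus,
      numeratorForm]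
    push_cast
    linear_combination h

/-! ### The instanton sums of the A-model -/

lemma instantonArea_eq (β : Fin 3 → ℝ) (k : ℤ) :
    instantonArea β k = (totalShift β + k) ^ 2 / 4 := by
  have h : ((vertexL2S1 β k).1 - (vertexL1L2 β k).1) * ((vertexS1L1 β k).2 - (vertexL1L2 β k).2) -
      ((vertexL2S1 β k).2 - (vertexL1L2 β k).2) * ((vertexS1L1 β k).1 - (vertexL1L2 β k).1) =
      -((totalShift β + k) ^ 2 / 2) := by
    simp only [vertexL1L2, vertexL2S1, vertexS1L1, totalShift]
    ring
  rw [instantonArea, triangleArea, h, abs_neg, abs_of_nonneg (by positivity)]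
  ring

lemma instantonPhase_eq (α β : Fin 3 → ℝ) (s : Sector) (k : ℤ) :
    instantonPhase α β s k = totalWilson α s * (totalShift β + k) / 2 := by
  simp only [instantonPhase, windingLength, vertexL1L2, vertexL2S1, vertexS1L1, totalShift,
    totalWilson, Fin.sum_univ_three]
  ring

/-- Instantons with odd lattice shift `k = 2n + 1`: expanding the squares splits off the
anomalous factor. -/
lemma instantonTerm_odd (τ : ℂ) (α β : Fin 3 → ℝ) (s : Sector) (n : ℤ) :
    instantonTerm τ α β s (2 * n + 1) =
      anomalyFactor τ α β s * deltaTerm τ (mirrorModulus τ α β s) n := by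
  simp only [instantonTerm, anomalyFactor, deltaTerm, mirrorModulus, instantonArea_eq,
    instantonPhase_eq, ← Complex.exp_add]
  push_cast
  ring_nf

lemma instantonTerm_even (τ : ℂ) (α β : Fin 3 → ℝ) (s : Sector) (n : ℤ) :
    instantonTerm τ α β s (2 * n) =
      anomalyFactor τ α β s * deltaBarTerm τ (mirrorModulus τ α β s) n := by
  simp only [instantonTerm, anomalyFactor, deltaBarTerm, mirrorModulus, instantonArea_eq,
    instantonPhase_eq, ← Complex.exp_add]
  push_cast
  ring_nf

lemma hasSum_deltaTerm {τ : ℂ} (hτ : 0 < τ.im) (u : ℂ) :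
    HasSum (deltaTerm τ u) (Theta2 (2 * u) (2 * τ)) := by
  convert hasSum_thetaChar (1 / 2) 0 (2 * u) (two_mul_im_pos hτ) using 1
  · funext n
    rw [deltaTerm]
    congr 2 <;> push_cast <;> ring
  · rfl

lemma hasSum_deltaBarTerm {τ : ℂ} (hτ : 0 < τ.im) (u : ℂ) :
    HasSum (deltaBarTerm τ u) (Theta3 (2 * u) (2 * τ)) := by
  convert hasSum_thetaChar 0 0 (2 * u) (two_mul_im_pos hτ) using 1
  · funext n
    rw [deltaBarTerm]
    congr 2 <;> push_cast <;> ring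
  · rfl

namespace Sector

/-- The sign of `2u + 1/2` in twice the modulus of a sector, under the mirror dictionary. -/
def mirrorSign : Sector → ℤˣ
  | bfb => -1
  | fff | fbb | bbf => 1

lemma modulus_mirrorBoundaryModuli (s : Sector) {τ : ℂ} {α β : Fin 3 → ℝ} {d : Fin 3 → ℂ}
    (hd : IsHalfPeriodShift s d) :
    2 * s.modulus (mirrorBoundaryModuli τ α β s d 0) (mirrorBoundaryModuli τ α β s d 1)
        (mirrorBoundaryModuli τ α β s d 2) =
      (s.mirrorSign : ℤ) * (2 * mirrorModulus τ α β s + 1 / 2) := by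
  rw [IsHalfPeriodShift] at hd
  cases s <;> simp only [orientation, Matrix.cons_val] at hd <;> push_cast at hd <;>
    simp only [modulus, mirrorBoundaryModuli, mirrorModulus, mirrorSign, totalShift, totalWilson,
      Fin.sum_univ_three, orientation, Matrix.cons_val] <;> push_cast <;>
    first
      | linear_combination hd
      | linear_combination -hd

end Sector

lemma Theta1_modulus_eq (s : Sector) {τ : ℂ} (hτ : 0 < τ.im) {α β : Fin 3 → ℝ} {d : Fin 3 → ℂ}
    (hd : IsHalfPeriodShift s d) :
    Theta1 (2 * s.modulus (mirrorBoundaryModuli τ α β s d 0) (mirrorBoundaryModuli τ α β s d 1)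
        (mirrorBoundaryModuli τ α β s d 2)) (2 * τ) =
      ((-s.mirrorSign : ℤˣ) : ℤ) * delta τ α β s := by
  rw [s.modulus_mirrorBoundaryModuli hd, delta, (hasSum_deltaTerm hτ _).tsum_eq]
  cases s <;> simp [Sector.mirrorSign, Theta1_add_half, Theta1_neg, -neg_add_rev, -one_div]

lemma Theta4_modulus_eq (s : Sector) {τ : ℂ} (hτ : 0 < τ.im) {α β : Fin 3 → ℝ} {d : Fin 3 → ℂ}
    (hd : IsHalfPeriodShift s d) :
    Theta4 (2 * s.modulus (mirrorBoundaryModuli τ α β s d 0) (mirrorBoundaryModuli τ α β s d 1)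
        (mirrorBoundaryModuli τ α β s d 2)) (2 * τ) = deltaBar τ α β s := by
  rw [s.modulus_mirrorBoundaryModuli hd, deltaBar, (hasSum_deltaBarTerm hτ _).tsum_eq]
  cases s <;> simp [Sector.mirrorSign, Theta4_add_half, Theta4_neg, -neg_add_rev, -one_div]

end QuarticTorus

end

open QuarticTorus in
theorem mainTheorem1 :
    ∃ (N : QuarticTorus.OpenString → ℂ → ℂ → ℂ → ℂ)
      (ε εbar δ δbar : QuarticTorus.Sector → ℤˣ),
      ∀ τ : ℂ, 0 < τ.im →
        -- the uniformized parameters give matrix factorizations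
        (∀ u : ℂ, QuarticTorus.IsGeneric τ u →
          QuarticTorus.alpha τ u 0 ^ 4 + QuarticTorus.alpha τ u 1 ^ 4
              - QuarticTorus.alpha τ u 2 ^ 2
              - QuarticTorus.bulkParam τ * QuarticTorus.alpha τ u 0 ^ 2
                * QuarticTorus.alpha τ u 1 ^ 2 = 0 ∧
          ∀ B : QuarticTorus.Brane,
            B.Q (QuarticTorus.alpha τ u) ^ 2 =
              QuarticTorus.superpotential (QuarticTorus.bulkParam τ) •
                (1 : QuarticTorus.SuperMatrix)) ∧
        -- the states are physical, and `N` is an admissible normalization factor for them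
        (∀ (s : QuarticTorus.OpenString) (u v : ℂ),
          QuarticTorus.IsGeneric τ u → QuarticTorus.IsGeneric τ v →
          s.IsPhysical (QuarticTorus.alpha τ u) (QuarticTorus.alpha τ v) ∧
          DifferentiableAt ℂ (fun z : ℂ × ℂ => N s τ z.1 z.2) (u, v) ∧
          (N s τ u v = 0 ↔
            s.mat (QuarticTorus.alpha τ u) (QuarticTorus.alpha τ v) = 0)) ∧
        -- the eight B-model correlators
        (∀ (s : QuarticTorus.Sector) (u₁ u₂ u₃ : ℂ),
          QuarticTorus.IsGeneric τ u₁ → QuarticTorus.IsGeneric τ u₂ →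
          QuarticTorus.IsGeneric τ u₃ →
          QuarticTorus.IsThreePoint τ s.longLong s.longShort s.shortLong u₁ u₂ u₃
            (((ε s : ℤ) : ℂ) *
              (N s.longLong τ u₁ u₂ * N s.longShort τ u₂ u₃ * N s.shortLong τ u₃ u₁) *
              QuarticTorus.Theta1 (2 * s.modulus u₁ u₂ u₃) (2 * τ)) ∧
          QuarticTorus.IsThreePoint τ s.longLongBar s.longShort s.shortLong u₁ u₂ u₃
            (((εbar s : ℤ) : ℂ) *
              (N s.longLongBar τ u₁ u₂ * N s.longShort τ u₂ u₃ * N s.shortLong τ u₃ u₁) *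
              QuarticTorus.Theta4 (2 * s.modulus u₁ u₂ u₃) (2 * τ))) ∧
        -- the A-model instanton sums
        (∀ (s : QuarticTorus.Sector) (α β : Fin 3 → ℝ),
          HasSum (fun n : ℤ => QuarticTorus.instantonTerm τ α β s (2 * n + 1))
            (QuarticTorus.anomalyFactor τ α β s * QuarticTorus.delta τ α β s) ∧
          HasSum (fun n : ℤ => QuarticTorus.instantonTerm τ α β s (2 * n))
            (QuarticTorus.anomalyFactor τ α β s * QuarticTorus.deltaBar τ α β s) ∧
          HasSum (QuarticTorus.deltaTerm τ (QuarticTorus.mirrorModulus τ α β s))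
            (QuarticTorus.Theta2 (2 * QuarticTorus.mirrorModulus τ α β s) (2 * τ)) ∧
          HasSum (QuarticTorus.deltaBarTerm τ (QuarticTorus.mirrorModulus τ α β s))
            (QuarticTorus.Theta3 (2 * QuarticTorus.mirrorModulus τ α β s) (2 * τ))) ∧
        -- the half-period shift
        (∀ z : ℂ,
          QuarticTorus.Theta2 z τ = -QuarticTorus.Theta1 (z + 1 / 2) τ ∧
          QuarticTorus.Theta3 z τ = QuarticTorus.Theta4 (z + 1 / 2) τ) ∧
        -- agreement of the B-model correlators with the A-model instanton sums
        (∀ (s : QuarticTorus.Sector) (α β : Fin 3 → ℝ) (d u : Fin 3 → ℂ),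
          QuarticTorus.IsHalfPeriodShift s d →
          u = QuarticTorus.mirrorBoundaryModuli τ α β s d →
          (∀ i, QuarticTorus.IsGeneric τ (u i)) →
          QuarticTorus.IsThreePoint τ s.longLong s.longShort s.shortLong (u 0) (u 1) (u 2)
            (((δ s : ℤ) : ℂ) *
              (N s.longLong τ (u 0) (u 1) * N s.longShort τ (u 1) (u 2)
                * N s.shortLong τ (u 2) (u 0)) * QuarticTorus.delta τ α β s) ∧
          QuarticTorus.IsThreePoint τ s.longLongBar s.longShort s.shortLong (u 0) (u 1) (u 2)
            (((δbar s : ℤ) : ℂ) *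
              (N s.longLongBar τ (u 0) (u 1) * N s.longShort τ (u 1) (u 2)
                * N s.shortLong τ (u 2) (u 0)) * QuarticTorus.deltaBar τ α β s)) := by
  refine ⟨OpenString.norm, Sector.sign, Sector.signBar,
    fun s => -(s.sign * s.mirrorSign), Sector.signBar, fun τ hτ => ⟨fun u hu => ?_,
    fun s u v hu hv => ?_, fun s u v w hu hv hw => ?_, fun s α β => ?_, fun z => ?_,
    fun s α β d u hd hu hg => ?_⟩⟩
  · exact ⟨alpha_curve hτ hu, fun B => B.Q_sq hu (alpha_curve hτ hu)⟩
  · exact ⟨s.isPhysical hu hv (alpha_curve hτ hu) (alpha_curve hτ hv),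
      s.differentiableAt_norm hτ hu hv, s.norm_eq_zero_iff hτ hu hv⟩
  · exact ⟨isThreePoint_theta_one s hτ hu hv hw, isThreePoint_theta_four s hτ hu hv hw⟩
  · have h := hasSum_deltaTerm hτ (mirrorModulus τ α β s)
    have hbar := hasSum_deltaBarTerm hτ (mirrorModulus τ α β s)
    refine ⟨?_, ?_, h, hbar⟩
    · simp only [instantonTerm_odd]
      exact h.summable.hasSum.mul_left _
    · simp only [instantonTerm_even]
      exact hbar.summable.hasSum.mul_left _
  · rw [Theta1_add_half, Theta4_add_half, neg_neg]
    exact ⟨rfl, rfl⟩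
  · have h₁ := isThreePoint_theta_one s hτ (hg 0) (hg 1) (hg 2)
    have h₄ := isThreePoint_theta_four s hτ (hg 0) (hg 1) (hg 2)
    subst hu
    rw [Theta1_modulus_eq s hτ hd] at h₁
    rw [Theta4_modulus_eq s hτ hd] at h₄
    refine ⟨?_, h₄⟩
    convert h₁ using 1
    push_cast
    ring
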